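/- Let $X$ be an infinite compact metrizable space and let $\sigma : X \to X$ be a minimal homeomorphism (no closed sets $E$ with $\sigma(E)=E$ besides $\emptyset$ and $X$). Let $A = \mathrm{C}(X)\rtimes_\sigma \mathbb{Z}$ be the crossed product C*-algebra, i.e. the universal C*-algebra generated by $\mathrm{C}(X)$ and a (canonical) unitary $u$ subject to $u f u^* = f\circ\sigma^{-1}$ for $f \in \mathrm{C}(X)$. For a closed set $Y \subseteq X$ put $$A_Y = \mathrm{C}^*\{f,\ ug \;;\; f, g \in \mathrm{C}(X),\ g|_Y = 0\} \subseteq A .$$ A C*-algebra $S$ is subhomogeneous if its irreducible representations are finite dimensional with bounded dimensions; its dimension ratio is then $$\mathrm{dimRatio}(S) = \max_{d}\ \frac{\dim \mathrm{Prim}_d(S)}{d},$$ where $d$ runs over the dimensions of the irreducible representations of $S$, $\mathrm{Prim}_d(S)$ is the set of kernels of $d$-dimensional irreducible representations with the hull-kernel topology, and $\dim$ is the topological covering dimension. Let $y \in X$, let $W$ be an open set containing $y$, and let $f_1,\dots,f_n,g_1,\dots,g_m \in \mathrm{C}(X)$ be such that every $g_j$ vanishes on $W$. Then for every $\varepsilon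 > 0$ there is $R > 0$ such that for every $J \in \mathbb{N}$ there are a closed neighborhood $Y$ of $y$ with $Y \subseteq W$ and a subhomogeneous unital sub-C*-algebra $S \subseteq A_Y$ such that 1. each element of $\{f_1,\dots,f_n, ug_1,\dots,ug_m\}$ is at norm distance less than $\varepsilon$ from some element of $S$; 2. $\mathrm{dimRatio}(S) \le R$; 3. every irreducible representation of $S$ has dimension at least $J$. -/

import Mathlib

open scoped ENNReal Topology

universe u

noncomputable section

/-! ### The crossed product of `C(X)` by a homeomorphism -/

section CrossedProduct

variable {X : Type u} [TopologicalSpace X]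

/-- A homeomorphism is minimal if it has no invariant closed sets besides `∅` and `X`. -/
def IsMinimalHomeo (σ : X ≃ₜ X) : Prop :=
  ∀ E : Set X, IsClosed E → σ '' E = E → E = ∅ ∨ E = Set.univ

/-- The automorphism `f ↦ f ∘ σ⁻¹` of `C(X)`, as a function. -/
def transl (σ : X ≃ₜ X) (f : C(X, ℂ)) : C(X, ℂ) :=
  f.comp ⟨σ.symm, σ.symm.continuous⟩

/-- A covariant representation of `(X, σ)` in a nonzero unital C*-algebra `B`: a unital
`*`-homomorphism `π : C(X) → B` and a unitary `U` of `B` such that `U π(f) U* = π(f ∘ σ⁻¹)`. -/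
structure CovariantRep (σ : X ≃ₜ X) : Type (u + 1) where
  B : Type u
  [cstar : CStarAlgebra B]
  [nontrivial : Nontrivial B]
  π : C(X, ℂ) →⋆ₐ[ℂ] B
  U : B
  unitary_mem : U ∈ unitary B
  covariant : ∀ f : C(X, ℂ), U * π f * star U = π (transl σ f)

instance (σ : X ≃ₜ X) (c : CovariantRep σ) : CStarAlgebra c.B := c.cstar
instance (σ : X ≃ₜ X) (c : CovariantRep σ) : Nontrivial c.B := c.nontrivial

instance instCStarAlgebraLp {I : Type*} {A : I → Type*} [∀ i, Nontrivial (A i)]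
    [∀ i, CStarAlgebra (A i)] : CStarAlgebra (lp A ∞) where

/-- The C*-algebra of bounded families `(b_c)`, indexed by all covariant representations `c`,
with `b_c` in the target algebra of `c`. -/
abbrev CovariantProd (σ : X ≃ₜ X) : Type (u + 1) := lp (fun c : CovariantRep σ => c.B) ∞

variable [CompactSpace X]

/-- The family `(π_c(f))_c`. -/
def famFun (σ : X ≃ₜ X) (f : C(X, ℂ)) : CovariantProd σ :=
  ⟨fun c => c.π f, memℓp_infty ⟨‖f‖, by
    rintro _ ⟨c, rfl⟩
    exact NonUnitalStarAlgHom.norm_apply_le c.π f⟩⟩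

/-- The family `(U_c)_c`. -/
def famU (σ : X ≃ₜ X) : CovariantProd σ :=
  ⟨fun c => c.U, memℓp_infty ⟨1, by
    rintro _ ⟨c, rfl⟩
    exact (CStarRing.norm_of_mem_unitary c.unitary_mem).le⟩⟩

/-- The closed unital `*`-subalgebra generated by the families `(π_c(f))_c` and `(U_c)_c`. -/
def crossedSubalgebra (σ : X ≃ₜ X) : StarSubalgebra ℂ (CovariantProd σ) :=
  (StarAlgebra.adjoin ℂ (Set.range (famFun σ) ∪ {famU σ})).topologicalClosure

/-- The (full) crossed product `C(X) ⋊_σ ℤ`: the universal C*-algebra generated by `C(X)` and a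
unitary `u` with `u f u* = f ∘ σ⁻¹`.  It is built as the C*-algebra generated by the universal
covariant pair in the product of all covariant representations, so that the norm of a polynomial
in `f` and `u` is the supremum of its norms in all covariant representations.
Its universal property is `CrossedProduct.existsUnique_lift` below. -/
abbrev CrossedProduct (σ : X ≃ₜ X) : Type (u + 1) := crossedSubalgebra σ

namespace CrossedProduct

instance (σ : X ≃ₜ X) : IsClosed (crossedSubalgebra σ : Set (CovariantProd σ)) :=
  StarSubalgebra.isClosed_topologicalClosure _

instance (σ : X ≃ₜ X) : CStarAlgebra (CrossedProduct σ) := inferInstance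

/-- The canonical `*`-homomorphism `C(X) → C(X) ⋊_σ ℤ`. -/
def ofFun (σ : X ≃ₜ X) : C(X, ℂ) →⋆ₐ[ℂ] CrossedProduct σ where
  toFun f := ⟨famFun σ f, StarSubalgebra.le_topologicalClosure _
    (StarAlgebra.subset_adjoin ℂ _ (Or.inl ⟨f, rfl⟩))⟩
  map_one' := Subtype.ext <| Subtype.ext <| funext fun c => map_one c.π
  map_mul' f g := Subtype.ext <| Subtype.ext <| funext fun c => map_mul c.π f g
  map_zero' := Subtype.ext <| Subtype.ext <| funext fun c => map_zero c.π
  map_add' f g := Subtype.ext <| Subtype.ext <| funext fun c => map_add c.π f g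
  commutes' r := Subtype.ext <| Subtype.ext <| funext fun c => AlgHomClass.commutes c.π r
  map_star' f := Subtype.ext <| Subtype.ext <| funext fun c => map_star c.π f

/-- The canonical unitary of `C(X) ⋊_σ ℤ`. -/
def u (σ : X ≃ₜ X) : CrossedProduct σ :=
  ⟨famU σ, StarSubalgebra.le_topologicalClosure _ (StarAlgebra.subset_adjoin ℂ _ (Or.inr rfl))⟩

/-- Evaluation at one covariant representation. -/
def lift {σ : X ≃ₜ X} (c : CovariantRep σ) : CrossedProduct σ →⋆ₐ[ℂ] c.B where
  toFun a := a.1 c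
  map_one' := rfl
  map_mul' _ _ := rfl
  map_zero' := rfl
  map_add' _ _ := rfl
  commutes' _ := rfl
  map_star' _ := rfl

theorem u_mem_unitary (σ : X ≃ₜ X) : u σ ∈ unitary (CrossedProduct σ) :=
  ⟨Subtype.ext <| Subtype.ext <| funext fun c => c.unitary_mem.1,
    Subtype.ext <| Subtype.ext <| funext fun c => c.unitary_mem.2⟩

theorem covariant (σ : X ≃ₜ X) (f : C(X, ℂ)) :
    u σ * ofFun σ f * star (u σ) = ofFun σ (transl σ f) :=
  Subtype.ext <| Subtype.ext <| funext fun c => c.covariant f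

theorem existsUnique_lift {σ : X ≃ₜ X} (c : CovariantRep σ) :
    ∃! φ : CrossedProduct σ →⋆ₐ[ℂ] c.B, (∀ f, φ (ofFun σ f) = c.π f) ∧ φ (u σ) = c.U := by
  refine ⟨lift c, ⟨fun _ => rfl, rfl⟩, ?_⟩
  rintro φ ⟨h1, h2⟩
  refine StarAlgHom.ext_topologicalClosure (φ := φ) (ψ := lift c)
    (S := StarAlgebra.adjoin ℂ (Set.range (famFun σ) ∪ {famU σ})) ?_ ?_ ?_
  · exact AddMonoidHomClass.continuous_of_bound φ 1 fun a => by
      simpa using NonUnitalStarAlgHom.norm_apply_le φ a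
  · exact AddMonoidHomClass.continuous_of_bound (lift c) 1 fun a => by
      simpa using NonUnitalStarAlgHom.norm_apply_le (lift c) a
  · refine StarAlgHom.ext_adjoin (fun a ha => ?_)
    obtain ⟨a, ha'⟩ := a
    rcases ha with ⟨f, rfl⟩ | rfl
    · exact h1 f
    · exact h2

/-- The subalgebra `A_Y = C*{f, ug ; f, g ∈ C(X), g|_Y = 0}` of `A = C(X) ⋊_σ ℤ`. -/
def orbitBreaking (σ : X ≃ₜ X) (Y : Set X) : StarSubalgebra ℂ (CrossedProduct σ) :=
  (StarAlgebra.adjoin ℂ (Set.range (ofFun σ) ∪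
    {a | ∃ g : C(X, ℂ), (∀ x ∈ Y, g x = 0) ∧ a = u σ * ofFun σ g})).topologicalClosure

end CrossedProduct

end CrossedProduct

/-! ### Covering dimension -/

section CoveringDimension

variable (T : Type*) [TopologicalSpace T]

/-- `dim T ≤ n`: every finite open cover has a finite open refinement of order at most `n`,
that is, no point lies in more than `n + 1` of its members. -/
def CoveringDimLE (n : ℕ) : Prop :=
  ∀ (ι : Type) [Finite ι] (V : ι → Set T), (∀ i, IsOpen (V i)) → (⋃ i, V i) = Set.univ →
    ∃ (κ : Type) (_ : Finite κ) (W : κ → Set T),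
      (∀ k, IsOpen (W k)) ∧ (⋃ k, W k) = Set.univ ∧ (∀ k, ∃ i, W k ⊆ V i) ∧
      ∀ x, {k | x ∈ W k}.ncard ≤ n + 1

/-- The topological covering dimension of a (nonempty) space; it is `⊤` if no `n` bounds it. -/
def coveringDim : ℕ∞ := ⨅ (n : ℕ) (_ : CoveringDimLE T n), (n : ℕ∞)

end CoveringDimension

/-! ### Irreducible representations, primitive ideals, and the dimension ratio -/

section Representations

variable (S : Type u) [NonUnitalRing S] [StarRing S] [Module ℂ S]

/-- An irreducible representation of a C*-algebra `S`: a nonzero `*`-homomorphism `π : S → B(H)`,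
with `H` a Hilbert space, such that `H` has no closed `π(S)`-invariant subspaces besides `0` and
`H`.  (Every irreducible representation of `S` is unitarily equivalent to one on a Hilbert space in
the universe of `S`, because it is a quotient of `S` as a vector space.) -/
structure IrrRep : Type (u + 1) where
  H : Type u
  [normed : NormedAddCommGroup H]
  [inner : InnerProductSpace ℂ H]
  [complete : CompleteSpace H]
  π : S →⋆ₙₐ[ℂ] (H →L[ℂ] H)
  ne_zero : π ≠ 0
  irreducible : ∀ K : Submodule ℂ H, IsClosed (K : Set H) →
    (∀ a : S, ∀ v ∈ K, π a v ∈ K) → K = ⊥ ∨ K = ⊤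

attribute [instance] IrrRep.normed IrrRep.inner IrrRep.complete

variable {S}

/-- The irreducible representation `ρ` has (finite) dimension `d`. -/
def IrrRep.HasDim (ρ : IrrRep S) (d : ℕ) : Prop :=
  FiniteDimensional ℂ ρ.H ∧ Module.finrank ℂ ρ.H = d

/-- The kernel of an irreducible representation, a primitive ideal of `S`. -/
def IrrRep.ker (ρ : IrrRep S) : TwoSidedIdeal S := TwoSidedIdeal.ker ρ.π

variable (S)

/-- A C*-algebra is subhomogeneous if its irreducible representations are finite dimensional, of
bounded dimension. -/
def IsSubhomogeneous : Prop :=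
  ∃ N : ℕ, ∀ ρ : IrrRep S, ∃ d ≤ N, ρ.HasDim d

/-- The primitive ideal space of `S`, as a set. -/
def Prim : Type u := {P : TwoSidedIdeal S // ∃ ρ : IrrRep S, ρ.ker = P}

/-- The hull-kernel (Jacobson) topology.  Its open sets are the sets `{P | ¬ I ⊆ P}` with `I` an
ideal; such a set is the union of the sets `{P | a ∉ P}` with `a ∈ I`. -/
instance : TopologicalSpace (Prim S) :=
  TopologicalSpace.generateFrom {O | ∃ a : S, O = {P : Prim S | a ∉ P.1}}

/-- `Prim_d(S)`: the primitive ideals that are kernels of `d`-dimensional irreducible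
representations, with the topology of the subspace of `Prim S`. -/
def primOfDim (d : ℕ) : Set (Prim S) :=
  {P | ∃ ρ : IrrRep S, ρ.HasDim d ∧ ρ.ker = P.1}

/-- The dimension ratio of a subhomogeneous C*-algebra: the maximum of `dim (Prim_d(S)) / d` over
the (finitely many) dimensions `d` of irreducible representations of `S`. -/
def dimRatio : ℝ≥0∞ :=
  ⨆ (d : ℕ) (_ : ∃ ρ : IrrRep S, ρ.HasDim d), (coveringDim (primOfDim S d) : ℝ≥0∞) / (d : ℝ≥0∞)

end Representations

end

/-! Take a real cutoff `h` that vanishes on a neighbourhood `Y` of `y` and equals one off a small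
subset of `W`. Let `S` be generated by `h`, the real and imaginary parts of all `f_i` and `g_j`, and
`T = u h`. Then `S` contains every `f_i` and, since `h g_j = g_j`, every `u g_j`. It is generated by
a fixed number `c` of functions besides `T`, and this, rather than the dimension of `X`, controls
the dimension ratio.

Irreducible representations of `S` are found from the grading by powers of `u`. The homogeneous
elements `uⁿ a` span a dense subspace of `S`, and their degrees are bounded because every orbit
meets `Y` within bounded time. Hence there is a nonzero bottom vector, which no element of negative
degree moves off zero. Elements of degree zero act on it as evaluation at some point `x`
(`IrrRep.exists_point`), and `T` carries it along `x, σ x, …` until the orbit meets `Y`. These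
vectors form a basis (`IrrRep.exists_isOrbitBasis`), so the dimension is a return time to `Y`:
bounded above by minimality, and large if `Y` is small.

The topology of `Prim_d(S)` is induced by the values of the `c` functions at the `d` points of the
segment, that is, by a map into `ℝ^(c d)` (`IrrRep.coveringDim_primOfDim_le`). Since `ℝ^k` is a
union of `k + 1` zero-dimensional pieces, `dim Prim_d(S) ≤ c d`. The ratio is at most `c`, a number
fixed before `J`. -/

/-! ### Covering dimension of subspaces of Euclidean space -/

/-- A space has large inductive dimension at most zero if disjoint closed sets are separated by a
clopen set. -/
def IndZero (T : Type*) [TopologicalSpace T] : Prop :=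
  ∀ A B : Set T, IsClosed A → IsClosed B → Disjoint A B →
    ∃ C : Set T, IsClopen C ∧ A ⊆ C ∧ Disjoint C B

/-- By the Lindelöf property, countably many clopen sets, each missing `A` or `B`, cover the space.
Making them disjoint keeps them clopen, and the pieces meeting `A` together form the separating set.
-/
theorem IndZero.of_clopen_nhds {T : Type*} [TopologicalSpace T] [SecondCountableTopology T]
    (hT : ∀ x : T, ∀ U ∈ 𝓝 x, ∃ C : Set T, IsClopen C ∧ x ∈ C ∧ C ⊆ U) : IndZero T := by
  intro A B hA hB hAB
  have key : ∀ x : T, ∃ C : Set T, IsClopen C ∧ x ∈ C ∧ (Disjoint C A ∨ Disjoint C B) := by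
    intro x
    by_cases hx : x ∈ A
    · obtain ⟨C, hC, hxC, hCU⟩ := hT x Bᶜ
        (hB.isOpen_compl.mem_nhds (Set.disjoint_left.mp hAB hx))
      exact ⟨C, hC, hxC, Or.inr (Set.subset_compl_iff_disjoint_right.mp hCU)⟩
    · obtain ⟨C, hC, hxC, hCU⟩ := hT x Aᶜ (hA.isOpen_compl.mem_nhds hx)
      exact ⟨C, hC, hxC, Or.inl (Set.subset_compl_iff_disjoint_right.mp hCU)⟩
  choose C hC hxC hCd using key
  obtain ⟨s, hs, hsU⟩ := TopologicalSpace.countable_cover_nhds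
    (fun x => (hC x).isOpen.mem_nhds (hxC x))
  rcases isEmpty_or_nonempty T with hE | ⟨⟨t0⟩⟩
  · exact ⟨∅, isClopen_empty, fun x => (hE.false x).elim, Set.empty_disjoint _⟩
  have hsne : s.Nonempty := by
    have : t0 ∈ ⋃ x ∈ s, C x := hsU ▸ Set.mem_univ t0
    simp only [Set.mem_iUnion] at this
    obtain ⟨x, hx, -⟩ := this
    exact ⟨x, hx⟩
  obtain ⟨e, he⟩ := hs.exists_eq_range hsne
  let D : ℕ → Set T := disjointed fun n => C (e n)
  have hDo : ∀ n, IsClopen (D n) := fun n =>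
    disjointedRec (p := IsClopen) (fun t i ht => ht.diff (hC _)) (hC (e n))
  have hDU : ⋃ n, D n = Set.univ := by
    rw [iUnion_disjointed, ← hsU, he, Set.biUnion_range]
  have hDd := disjoint_disjointed fun n => C (e n)
  have hDs : ∀ n, D n ⊆ C (e n) := disjointed_subset _
  refine ⟨⋃ n ∈ {n | ¬ Disjoint (D n) A}, D n, ⟨?_, ?_⟩, ?_, ?_⟩
  · have : (⋃ n ∈ {n | ¬ Disjoint (D n) A}, D n) = (⋃ n ∈ {n | Disjoint (D n) A}, D n)ᶜ := by
      ext x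
      have hx : x ∈ ⋃ n, D n := hDU ▸ Set.mem_univ x
      obtain ⟨k, hk⟩ := Set.mem_iUnion.mp hx
      have huniq : ∀ n, x ∈ D n → n = k := fun n hn => by
        by_contra hne
        exact Set.disjoint_left.mp (hDd hne) hn hk
      simp only [Set.mem_ofPred_eq, Set.mem_iUnion, Set.mem_compl_iff, exists_prop, not_exists,
        not_and]
      constructor
      · rintro ⟨n, hn, hxn⟩ m hm hxm
        rw [huniq n hxn] at hn
        rw [huniq m hxm] at hm
        exact hn hm
      · intro h
        exact ⟨k, fun hd => h k hd hk, hk⟩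
    rw [this]
    exact (isOpen_biUnion fun n _ => (hDo n).isOpen).isClosed_compl
  · exact isOpen_biUnion fun n _ => (hDo n).isOpen
  · intro x hx
    have hx' : x ∈ ⋃ n, D n := hDU ▸ Set.mem_univ x
    obtain ⟨k, hk⟩ := Set.mem_iUnion.mp hx'
    exact Set.mem_biUnion (show k ∈ {n | ¬ Disjoint (D n) A} from
      fun hd => Set.disjoint_left.mp hd hk hx) hk
  · simp only [Set.disjoint_iUnion_left]
    intro n hn
    rcases hCd (e n) with h | h
    · exact absurd (h.mono_left (hDs n)) hn
    · exact h.mono_left (hDs n)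

/-- The countable sum theorem in dimension zero. -/
theorem IndZero.of_iUnion_closed {T : Type*} [TopologicalSpace T] [NormalSpace T]
    (F : ℕ → Set T) (hF : ∀ n, IsClosed (F n)) (hU : ⋃ n, F n = Set.univ)
    (h0 : ∀ n, IndZero (F n)) : IndZero T := by
  intro A B hA hB hAB
  -- Pairs of open sets with disjoint closures are enlarged in turn, the `n`-th step covering `F n`.
  -- The unions of the two increasing sequences are then complementary open sets.
  let Q := {p : Set T × Set T // IsOpen p.1 ∧ IsOpen p.2 ∧ Disjoint (closure p.1) (closure p.2)}
  have enlarge : ∀ A B : Set T, IsClosed A → IsClosed B → Disjoint A B →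
      ∃ q : Q, A ⊆ q.1.1 ∧ B ⊆ q.1.2 := by
    intro A B hA hB hAB
    obtain ⟨U, hU, hAU, hUB⟩ := normal_exists_closure_subset hA hB.isOpen_compl
      (Set.subset_compl_iff_disjoint_right.mpr hAB)
    obtain ⟨V, hV, hBV, hVU⟩ := normal_exists_closure_subset hB
      (isClosed_closure (s := U)).isOpen_compl
      (Set.subset_compl_iff_disjoint_right.mpr
        (Set.subset_compl_iff_disjoint_right.mp hUB).symm)
    exact ⟨⟨(U, V), hU, hV, (Set.subset_compl_iff_disjoint_right.mp hVU).symm⟩, hAU, hBV⟩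
  have step : ∀ (n : ℕ) (q : Q), ∃ r : Q, q.1.1 ⊆ r.1.1 ∧ q.1.2 ⊆ r.1.2 ∧
      F n ⊆ r.1.1 ∪ r.1.2 := by
    rintro n ⟨⟨U, V⟩, hUo, hVo, hd⟩
    obtain ⟨C, hC, hUC, hCV⟩ := h0 n (Subtype.val ⁻¹' closure U) (Subtype.val ⁻¹' closure V)
      (isClosed_closure.preimage continuous_subtype_val)
      (isClosed_closure.preimage continuous_subtype_val) (hd.preimage _)
    -- As `F n` is closed, both halves of its clopen partition are closed in the whole space, and
    -- normality applies again.
    have hemb := (hF n).isClosedEmbedding_subtypeVal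
    have hC1 : IsClosed (Subtype.val '' C) := hemb.isClosedMap _ hC.isClosed
    have hC2 : IsClosed (Subtype.val '' Cᶜ) := hemb.isClosedMap _ hC.compl.isClosed
    obtain ⟨r, hr1, hr2⟩ := enlarge (closure U ∪ Subtype.val '' C) (closure V ∪ Subtype.val '' Cᶜ)
      (isClosed_closure.union hC1) (isClosed_closure.union hC2) (by
        rw [Set.disjoint_union_left, Set.disjoint_union_right, Set.disjoint_union_right]
        refine ⟨⟨hd, ?_⟩, ?_, ?_⟩
        · rw [Set.disjoint_left]
          rintro _ hx ⟨x, hxC, rfl⟩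
          exact hxC (hUC hx)
        · rw [Set.disjoint_left]
          rintro _ ⟨x, hxC, rfl⟩ hx
          exact Set.disjoint_left.mp hCV hxC hx
        · rw [Set.disjoint_left]
          rintro _ ⟨x, hxC, rfl⟩ ⟨x', hx', he⟩
          exact hx' (Subtype.val_injective he ▸ hxC))
    refine ⟨r, fun x hx => hr1 (Or.inl (subset_closure hx)),
      fun x hx => hr2 (Or.inl (subset_closure hx)), fun x hx => ?_⟩
    by_cases hxC : (⟨x, hx⟩ : F n) ∈ C
    · exact Or.inl (hr1 (Or.inr ⟨_, hxC, rfl⟩))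
    · exact Or.inr (hr2 (Or.inr ⟨_, hxC, rfl⟩))
  choose nxt hn1 hn2 hn3 using step
  obtain ⟨q0, hq1, hq2⟩ := enlarge A B hA hB hAB
  let q : ℕ → Q := fun n => Nat.rec q0 (fun n q => nxt n q) n
  have hm1 : Monotone fun n => (q n).1.1 := monotone_nat_of_le_succ fun n => hn1 n (q n)
  have hm2 : Monotone fun n => (q n).1.2 := monotone_nat_of_le_succ fun n => hn2 n (q n)
  have hdisj : Disjoint (⋃ n, (q n).1.1) (⋃ n, (q n).1.2) := by
    simp only [Set.disjoint_iUnion_left, Set.disjoint_iUnion_right]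
    intro i j
    exact ((q (max i j)).2.2.2.mono subset_closure subset_closure).mono
      (hm1 (le_max_right i j)) (hm2 (le_max_left i j))
  have hcov : (⋃ n, (q n).1.1) ∪ (⋃ n, (q n).1.2) = Set.univ := by
    refine Set.eq_univ_of_forall fun x => ?_
    have hx : x ∈ ⋃ n, F n := hU ▸ Set.mem_univ x
    obtain ⟨n, hn⟩ := Set.mem_iUnion.mp hx
    rcases hn3 n (q n) hn with h | h
    · exact Or.inl (Set.mem_iUnion.mpr ⟨n + 1, h⟩)
    · exact Or.inr (Set.mem_iUnion.mpr ⟨n + 1, h⟩)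
  have ho1 : IsOpen (⋃ n, (q n).1.1) := isOpen_iUnion fun n => (q n).2.1
  have ho2 : IsOpen (⋃ n, (q n).1.2) := isOpen_iUnion fun n => (q n).2.2.1
  refine ⟨⋃ n, (q n).1.1, ⟨?_, ho1⟩, fun x hx => Set.mem_iUnion.mpr ⟨0, hq1 hx⟩,
    hdisj.mono_right fun x hx => Set.mem_iUnion.mpr ⟨0, hq2 hx⟩⟩
  have hc : IsCompl (⋃ n, (q n).1.1) (⋃ n, (q n).1.2) :=
    ⟨hdisj, codisjoint_iff.mpr hcov⟩
  rw [← isOpen_compl_iff, hc.compl_eq]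
  exact ho2

/-- In a space of dimension zero, every finite open cover has a disjoint open refinement. -/
theorem IndZero.exists_disjoint_refinement {T : Type*} [TopologicalSpace T] [NormalSpace T]
    (hT : IndZero T) {ι : Type*} [Finite ι] (V : ι → Set T) (hV : ∀ i, IsOpen (V i))
    (hU : ⋃ i, V i = Set.univ) :
    ∃ E : ι → Set T, (∀ i, E i ⊆ V i) ∧ ⋃ i, E i = Set.univ ∧
      (∀ i, IsOpen (E i)) ∧ Pairwise (Function.onFun Disjoint E) := by
  obtain ⟨n, ⟨e⟩⟩ := Finite.exists_equiv_fin ι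
  obtain ⟨K, hK, hKc, hKV⟩ := exists_iUnion_eq_closed_subset hV
    (fun x => Set.toFinite _) hU
  have : ∀ i, ∃ C : Set T, IsClopen C ∧ K i ⊆ C ∧ C ⊆ V i := by
    intro i
    obtain ⟨C, hC, h1, h2⟩ := hT (K i) (V i)ᶜ (hKc i) (hV i).isClosed_compl
      (Set.disjoint_compl_right_iff_subset.mpr (hKV i))
    exact ⟨C, hC, h1, Set.disjoint_compl_right_iff_subset.mp h2⟩
  choose C hC hKC hCV using this
  -- Subtracting from each clopen set its predecessors in the enumeration `e` makes the family
  -- disjoint without changing its union.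
  let D : ι → Set T := fun i => C i \ ⋃ j ∈ {j | e j < e i}, C j
  refine ⟨D, fun i => Set.sdiff_subset.trans (hCV i), Set.eq_univ_of_forall fun x => ?_,
    fun i => ?_, ?_⟩
  · have hne : {i | x ∈ C i}.Nonempty := by
      have hx : x ∈ ⋃ i, K i := hK ▸ Set.mem_univ x
      obtain ⟨i, hi⟩ := Set.mem_iUnion.mp hx
      exact ⟨i, hKC i hi⟩
    obtain ⟨i, hi, hmin⟩ := Set.exists_min_image _ e (Set.toFinite {i | x ∈ C i}) hne
    refine Set.mem_iUnion.mpr ⟨i, hi, ?_⟩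
    simp only [Set.mem_iUnion, Set.mem_ofPred_eq, exists_prop, not_exists, not_and]
    intro j hj hx
    exact absurd (hmin j hx) (not_le.mpr hj)
  · exact (hC i).isOpen.sdiff (Set.Finite.isClosed_biUnion (Set.toFinite _)
      fun j _ => (hC j).isClosed)
  · intro i j hij
    rw [Function.onFun, Set.disjoint_left]
    rintro x ⟨hxi, hxi'⟩ ⟨hxj, hxj'⟩
    simp only [Set.mem_iUnion, Set.mem_ofPred_eq, exists_prop, not_exists, not_and] at hxi' hxj'
    rcases lt_trichotomy (e i) (e j) with h | h | h
    · exact hxj' i h hxi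
    · exact hij (e.injective h)
    · exact hxi' j h hxj

/-- Disjoint relatively open sets in a subset of a metric space extend to disjoint open sets. -/
theorem exists_disjoint_open_extension {M : Type*} [PseudoMetricSpace M] {D : Set M}
    {ι : Type*} (E : ι → Set D) (hE : ∀ i, IsOpen (E i))
    (hd : Pairwise (Function.onFun Disjoint E)) :
    ∃ W : ι → Set M, (∀ i, IsOpen (W i)) ∧ (∀ i, Subtype.val '' E i ⊆ W i) ∧
      Pairwise (Function.onFun Disjoint W) := by
  let G : ι → Set M := fun i => Subtype.val '' E i
  let G' : ι → Set M := fun i => ⋃ j ∈ {j | j ≠ i}, G j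
  -- The extension of `E i` consists of the points strictly nearer to `E i` than to the union of the
  -- other sets.
  refine ⟨fun i => {z | Metric.infEDist z (G i) < Metric.infEDist z (G' i)}, fun i =>
    isOpen_lt Metric.continuous_infEDist Metric.continuous_infEDist, fun i => ?_, ?_⟩
  · rintro _ ⟨z, hz, rfl⟩
    have h1 : Metric.infEDist (z : M) (G i) = 0 :=
      Metric.infEDist_zero_of_mem ⟨z, hz, rfl⟩
    simp only [Set.mem_ofPred_eq, h1, pos_iff_ne_zero]
    intro h2
    rw [← Metric.mem_closure_iff_infEDist_zero] at h2
    obtain ⟨O, hO, hOE⟩ := isOpen_induced_iff.mp (hE i)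
    have hzO : (z : M) ∈ O := by
      have : z ∈ Subtype.val ⁻¹' O := hOE ▸ hz
      exact this
    obtain ⟨w, hwO, hw⟩ := mem_closure_iff.mp h2 O hO hzO
    simp only [G', Set.mem_iUnion, Set.mem_ofPred_eq, exists_prop] at hw
    obtain ⟨j, hj, w', hw', rfl⟩ := hw
    have : w' ∈ E i := hOE ▸ hwO
    exact Set.disjoint_left.mp (hd hj) hw' this
  · intro i j hij
    rw [Function.onFun, Set.disjoint_left]
    intro z hz1 hz2
    simp only [Set.mem_ofPred_eq] at hz1 hz2
    have a1 : Metric.infEDist z (G' i) ≤ Metric.infEDist z (G j) :=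
      Metric.infEDist_anti (Set.subset_biUnion_of_mem (u := G) (show j ∈ {j | j ≠ i} from hij.symm))
    have a2 : Metric.infEDist z (G' j) ≤ Metric.infEDist z (G i) :=
      Metric.infEDist_anti (Set.subset_biUnion_of_mem (u := G) (show i ∈ {i | i ≠ j} from hij))
    exact absurd (hz1.trans_le a1) (not_lt.mpr (a2.trans_lt' hz2 |>.le))

/-- Boxes with rational corners are clopen here: no point has an irrational coordinate on a face,
and a constant coordinate meets its constraint everywhere or nowhere. -/
theorem IndZero.of_isInducing {T κ : Type*} [TopologicalSpace T] [Finite κ] {p : T → κ → ℝ}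
    (hp : Topology.IsInducing p)
    (h : ∀ i, (∃ c, ∀ z, p z i = c) ∨ ∀ z, Irrational (p z i)) : IndZero T := by
  have := hp.secondCountableTopology
  refine IndZero.of_clopen_nhds fun x U hU => ?_
  rw [hp.nhds_eq_comap, Filter.mem_comap] at hU
  obtain ⟨V, hV, hVU⟩ := hU
  have := Fintype.ofFinite κ
  obtain ⟨δ, hδ, hball⟩ := Metric.mem_nhds_iff.mp hV
  choose a ha1 ha2 using fun i => exists_rat_btwn (show p x i - δ < p x i by linarith)
  choose b hb1 hb2 using fun i => exists_rat_btwn (show p x i < p x i + δ by linarith)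
  have hcont : ∀ i, Continuous fun z => p z i := fun i =>
    (continuous_apply i).comp hp.continuous
  refine ⟨⋂ i, {z | (a i : ℝ) < p z i ∧ p z i < b i}, ⟨?_, ?_⟩, ?_, ?_⟩
  · refine isClosed_iInter fun i => ?_
    rcases h i with ⟨c, hc⟩ | hirr
    · simp only [hc]
      exact isClosed_const
    · have : {z | (a i : ℝ) < p z i ∧ p z i < b i} = {z | (a i : ℝ) ≤ p z i ∧ p z i ≤ b i} := by
        ext z
        exact and_congr
          ⟨le_of_lt, fun hle => hle.lt_of_ne fun he => hirr z ⟨a i, he⟩⟩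
          ⟨le_of_lt, fun hle => hle.lt_of_ne fun he => hirr z ⟨b i, he.symm⟩⟩
      rw [this]
      exact (isClosed_le continuous_const (hcont i)).inter (isClosed_le (hcont i) continuous_const)
  · exact isOpen_iInter_of_finite fun i =>
      (isOpen_lt continuous_const (hcont i)).inter (isOpen_lt (hcont i) continuous_const)
  · exact Set.mem_iInter.mpr fun i => ⟨ha2 i, hb1 i⟩
  · intro z hz
    refine hVU (hball ?_)
    rw [Metric.mem_ball, dist_pi_lt_iff hδ]
    intro i
    obtain ⟨h1, h2⟩ := Set.mem_iInter.mp hz i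
    rw [Real.dist_eq, abs_lt]
    constructor <;> linarith [ha1 i, hb2 i]

/-- The points of a subset of `ℝ^κ` with exactly `j` rational coordinates form a space of
dimension zero. -/
theorem indZero_rational_coordinates {κ : Type*} [Finite κ] (U : Set (κ → ℝ)) (j : ℕ) :
    IndZero {z : κ → ℝ | z ∈ U ∧ {i | ¬ Irrational (z i)}.ncard = j} := by
  set T := {z : κ → ℝ | z ∈ U ∧ {i | ¬ Irrational (z i)}.ncard = j} with hT
  have := Fintype.ofFinite κ
  -- There are countably many choices of the set of rational coordinates and of their values. Each
  -- choice cuts out a closed piece.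
  obtain ⟨e, he⟩ := exists_surjective_nat (Set κ × (κ → ℚ))
  refine IndZero.of_iUnion_closed
    (fun n => {z : T | (e n).1.ncard = j ∧ ∀ i ∈ (e n).1, z.1 i = (e n).2 i}) (fun n => ?_) ?_
    fun n => ?_
  · simp only [Set.ofPred_and, Set.ofPred_forall]
    exact isClosed_const.inter (isClosed_iInter fun i => isClosed_iInter fun _ =>
      isClosed_eq ((continuous_apply i).comp continuous_subtype_val) continuous_const)
  · refine Set.eq_univ_of_forall fun z => Set.mem_iUnion.mpr ?_
    have : ∀ i, ∃ q : ℚ, ¬ Irrational (z.1 i) → z.1 i = q := by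
      intro i
      by_cases hi : Irrational (z.1 i)
      · exact ⟨0, fun h => absurd hi h⟩
      · obtain ⟨q, hq⟩ := not_not.mp hi
        exact ⟨q, fun _ => hq.symm⟩
    choose q hq using this
    obtain ⟨n, hn⟩ := he ({i | ¬ Irrational (z.1 i)}, q)
    refine ⟨n, ?_⟩
    simp only [Set.mem_ofPred_eq, hn]
    exact ⟨z.2.2, fun i hi => hq i hi⟩
  · refine IndZero.of_isInducing (p := fun z i => z.1.1 i)
      (Topology.IsInducing.subtypeVal.comp Topology.IsInducing.subtypeVal) fun i => ?_
    by_cases hi : i ∈ (e n).1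
    · exact Or.inl ⟨(e n).2 i, fun z => z.2.2 i hi⟩
    · refine Or.inr fun z => ?_
      have hsub : (e n).1 ⊆ {i | ¬ Irrational (z.1.1 i)} := fun k hk => by
        rw [Set.mem_ofPred_eq, z.2.2 k hk]
        exact fun hirr => hirr ⟨_, rfl⟩
      -- The `j` prescribed coordinates are rational and there are exactly `j` rational ones, so all
      -- others are irrational.
      have heq := Set.eq_of_subset_of_ncard_le hsub (by rw [z.1.2.2, z.2.1]) (Set.toFinite _)
      by_contra hz
      exact hi (heq ▸ hz)

/-- A space whose topology is induced by a map into `ℝ^κ` has covering dimension at most the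
cardinality of `κ`. -/
theorem CoveringDimLE.of_isInducing {T κ : Type*} [TopologicalSpace T] [Finite κ]
    {p : T → κ → ℝ} (hp : Topology.IsInducing p) : CoveringDimLE T (Nat.card κ) := by
  intro ι _ V hV hVU
  have := Fintype.ofFinite κ
  choose O hO hOV using fun i => isOpen_induced_iff.mp (hp.eq_induced ▸ hV i)
  -- For each number `j` of rational coordinates, a disjoint family of open sets of `ℝ^κ` covers
  -- that level. A point lies in at most one member per level, and there are `Nat.card κ + 1`
  -- levels.
  have key : ∀ j : ℕ, ∃ W : ι → Set (κ → ℝ), (∀ i, IsOpen (W i)) ∧ (∀ i, W i ⊆ O i) ∧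
      (∀ z ∈ ⋃ i, O i, {k | ¬ Irrational (z k)}.ncard = j → ∃ i, z ∈ W i) ∧
      Pairwise (Function.onFun Disjoint W) := by
    intro j
    obtain ⟨E, hEO, hEU, hEo, hEd⟩ :=
      (indZero_rational_coordinates (⋃ i, O i) j).exists_disjoint_refinement
      (fun i => Subtype.val ⁻¹' O i) (fun i => (hO i).preimage continuous_subtype_val)
      (Set.eq_univ_of_forall fun z => by
        obtain ⟨i, hi⟩ := Set.mem_iUnion.mp z.2.1
        exact Set.mem_iUnion.mpr ⟨i, hi⟩)
    obtain ⟨W, hWo, hEW, hWd⟩ := exists_disjoint_open_extension E hEo hEd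
    refine ⟨fun i => W i ∩ O i, fun i => (hWo i).inter (hO i), fun i => Set.inter_subset_right,
      fun z hz hzj => ?_, fun i k hik =>
        (hWd hik).mono Set.inter_subset_left Set.inter_subset_left⟩
    have hz' : (⟨z, hz, hzj⟩ : {z : κ → ℝ | z ∈ ⋃ i, O i ∧
        {i | ¬ Irrational (z i)}.ncard = j}) ∈ ⋃ i, E i := hEU ▸ Set.mem_univ _
    obtain ⟨i, hi⟩ := Set.mem_iUnion.mp hz'
    exact ⟨i, hEW i ⟨_, hi, rfl⟩, hEO i hi⟩
  choose W hWo hWO hWU hWd using key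
  refine ⟨ι × Fin (Nat.card κ + 1), inferInstance, fun k => p ⁻¹' W k.2 k.1,
    fun k => (hWo _ _).preimage hp.continuous, Set.eq_univ_of_forall fun x => ?_,
    fun k => ⟨k.1, ?_⟩, fun x => ?_⟩
  · have hx : p x ∈ ⋃ i, O i := by
      have hx : x ∈ ⋃ i, V i := hVU ▸ Set.mem_univ x
      obtain ⟨i, hi⟩ := Set.mem_iUnion.mp hx
      exact Set.mem_iUnion.mpr ⟨i, by rw [← hOV] at hi; exact hi⟩
    obtain ⟨i, hi⟩ := hWU {k | ¬ Irrational (p x k)}.ncard (p x) hx rfl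
    have hle : {k | ¬ Irrational (p x k)}.ncard ≤ Nat.card κ :=
      (Set.ncard_le_ncard (Set.subset_univ _)).trans (Set.ncard_univ κ).le
    exact Set.mem_iUnion.mpr ⟨(i, ⟨_, Nat.lt_succ_of_le hle⟩), hi⟩
  · rw [← hOV]
    exact Set.preimage_mono (hWO _ _)
  · have hinj : Set.InjOn Prod.snd {k : ι × Fin (Nat.card κ + 1) | x ∈ p ⁻¹' W k.2 k.1} := by
      rintro ⟨i, j⟩ hi ⟨i', j'⟩ hi' hjj
      obtain rfl : j = j' := hjj
      by_contra hne
      have hii : i ≠ i' := fun h => hne (by rw [h])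
      exact Set.disjoint_left.mp (hWd j hii) hi hi'
    calc _ = (Prod.snd '' {k : ι × Fin (Nat.card κ + 1) | x ∈ p ⁻¹' W k.2 k.1}).ncard :=
          hinj.ncard_image.symm
      _ ≤ (Set.univ : Set (Fin (Nat.card κ + 1))).ncard := Set.ncard_le_ncard (Set.subset_univ _)
      _ = Nat.card κ + 1 := by simp [Set.ncard_univ]

noncomputable section

open scoped InnerProductSpace

/-! ### Covariant pairs and homogeneous elements -/

/-- A covariant pair for `(X, σ)` in a C*-algebra. -/
structure CovariantPair {X : Type*} [TopologicalSpace X] (σ : X ≃ₜ X) (A : Type*)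
    [CStarAlgebra A] where
  π : C(X, ℂ) →⋆ₐ[ℂ] A
  U : unitary A
  covariant : ∀ f, (U : A) * π f = π (transl σ f) * U

/-- The function `a ∘ σⁿ`. -/
def shift {X : Type*} [TopologicalSpace X] (σ : X ≃ₜ X) (n : ℤ) (a : C(X, ℂ)) : C(X, ℂ) :=
  a.comp ⟨(σ ^ n : X ≃ₜ X), (σ ^ n : X ≃ₜ X).continuous⟩

@[simp]
theorem shift_apply {X : Type*} [TopologicalSpace X] (σ : X ≃ₜ X) (n : ℤ) (a : C(X, ℂ)) (x : X) :
    shift σ n a x = a ((σ ^ n) x) := rfl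

theorem Homeomorph.zpow_add_apply {X : Type*} [TopologicalSpace X] (σ : X ≃ₜ X) (n m : ℤ) (x : X) :
    (σ ^ (n + m)) x = (σ ^ n) ((σ ^ m) x) := by
  rw [zpow_add]; rfl

/-- The function `a` is supported where the orbit segment between `x` and `σⁿ x` avoids `Y`. -/
def Linked {X : Type*} [TopologicalSpace X] (σ : X ≃ₜ X) (Y : Set X) (n : ℤ) (a : C(X, ℂ)) : Prop :=
  ∀ x, a x ≠ 0 → ∀ k : ℤ, (0 ≤ k ∧ k < n ∨ n ≤ k ∧ k < 0) → (σ ^ k) x ∉ Y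

/-- The segment from `x` to `σ^(n+m) x` is covered by the one from `x` to `σ^m x` and the one from
there on, whatever the signs of `n` and `m`. -/
theorem Linked.mul {X : Type*} [TopologicalSpace X] {σ : X ≃ₜ X} {Y : Set X} {n m : ℤ}
    {a b : C(X, ℂ)} (ha : Linked σ Y n a) (hb : Linked σ Y m b) :
    Linked σ Y (n + m) (shift σ m a * b) := by
  intro x hx k hk
  have h1 : a ((σ ^ m) x) ≠ 0 := left_ne_zero_of_mul hx
  have h2 : b x ≠ 0 := right_ne_zero_of_mul hx
  by_cases hkm : 0 ≤ k ∧ k < m ∨ m ≤ k ∧ k < 0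
  · exact hb x h2 k hkm
  · have := ha _ h1 (k - m) (by omega)
    rwa [← Homeomorph.zpow_add_apply, sub_add_cancel] at this

theorem Linked.star {X : Type*} [TopologicalSpace X] {σ : X ≃ₜ X} {Y : Set X} {n : ℤ}
    {a : C(X, ℂ)} (ha : Linked σ Y n a) : Linked σ Y (-n) (shift σ (-n) (star a)) := by
  intro x hx k hk
  have h1 : a ((σ ^ (-n)) x) ≠ 0 := fun h => hx (by
    rw [shift_apply, ContinuousMap.star_apply, h, star_zero])
  have := ha _ h1 (k + n) (by omega)
  rwa [← Homeomorph.zpow_add_apply, add_neg_cancel_right] at this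

namespace CovariantPair

variable {X : Type*} [TopologicalSpace X] {σ : X ≃ₜ X} {A : Type*} [CStarAlgebra A]
  (P : CovariantPair σ A)

theorem π_mul_zpow (n : ℤ) (a : C(X, ℂ)) :
    P.π a * ((P.U ^ n : unitary A) : A) = ((P.U ^ n : unitary A) : A) * P.π (shift σ n a) := by
  have h1 : ∀ a, P.π a * (P.U : A) = P.U * P.π (shift σ 1 a) := fun a => by
    rw [P.covariant]
    congr 2
    ext x
    change a x = a ((σ ^ (1 : ℤ)) (σ.symm x))
    simp
  have h2 : ∀ a, P.π a * ((P.U⁻¹ : unitary A) : A)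
      = ((P.U⁻¹ : unitary A) : A) * P.π (shift σ (-1) a) := fun a => by
    have h' := h1 (shift σ (-1) a)
    have h3 : shift σ 1 (shift σ (-1) a) = a := by
      ext x
      rw [shift_apply, shift_apply, ← Homeomorph.zpow_add_apply]
      rfl
    rw [h3] at h'
    calc P.π a * ((P.U⁻¹ : unitary A) : A)
        = ((P.U⁻¹ : unitary A) : A) * (P.U * P.π a) * ((P.U⁻¹ : unitary A) : A) := by
          rw [← mul_assoc, ← Submonoid.coe_mul, inv_mul_cancel, Submonoid.coe_one, one_mul]
      _ = _ := by
          rw [← h', mul_assoc, mul_assoc, ← Submonoid.coe_mul, mul_inv_cancel, Submonoid.coe_one,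
            mul_one]
  induction n using Int.induction_on generalizing a with
  | zero =>
    have : shift σ 0 a = a := by ext x; simp
    simp [this]
  | succ n ih =>
    rw [zpow_add_one, Submonoid.coe_mul, ← mul_assoc, ih, mul_assoc, h1, mul_assoc]
    congr 3
  | pred n ih =>
    rw [zpow_sub_one, Submonoid.coe_mul, ← mul_assoc, ih, mul_assoc, h2, mul_assoc]
    congr 3
    ext x
    simp only [shift_apply, sub_eq_add_neg, Homeomorph.zpow_add_apply]

/-- The element `s` is of the form `uⁿ a`, with `a` supported where the orbit segment between `x`
and `σⁿ x` avoids `Y`. -/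
def Homog (Y : Set X) (n : ℤ) (a : C(X, ℂ)) (s : A) : Prop :=
  s = ((P.U ^ n : unitary A) : A) * P.π a ∧ Linked σ Y n a

variable {P} {Y : Set X} {n m : ℤ} {a b : C(X, ℂ)} {s t : A}

theorem Homog.mul (hs : P.Homog Y n a s) (ht : P.Homog Y m b t) :
    P.Homog Y (n + m) (shift σ m a * b) (s * t) := by
  refine ⟨?_, hs.2.mul ht.2⟩
  rw [hs.1, ht.1, mul_assoc, ← mul_assoc (P.π a), π_mul_zpow, zpow_add, Submonoid.coe_mul, map_mul]
  simp only [mul_assoc]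

theorem Homog.star (hs : P.Homog Y n a s) :
    P.Homog Y (-n) (shift σ (-n) (star a)) (star s) := by
  refine ⟨?_, hs.2.star⟩
  rw [hs.1, star_mul, ← map_star, ← Unitary.coe_star, Unitary.star_eq_inv, ← zpow_neg, π_mul_zpow]

theorem homog_zero (Y : Set X) (c : C(X, ℂ)) : P.Homog Y 0 c (P.π c) :=
  ⟨by simp, fun _ _ k hk => by omega⟩

theorem homog_one (Y : Set X) : P.Homog Y 0 1 1 := by
  simpa using P.homog_zero Y 1

theorem Homog.eq_zero (hs : P.Homog Y 0 a s) : s = P.π a := by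
  simpa using hs.1

theorem Homog.sub_smul (hs : P.Homog Y n a s) (ht : P.Homog Y n b t) (z : ℂ) :
    P.Homog Y n (a - z • b) (s - z • t) := by
  refine ⟨by rw [hs.1, ht.1, map_sub, map_smul, mul_sub, mul_smul_comm], fun x hx k hk => ?_⟩
  by_cases ha : a x = 0
  · refine ht.2 x (fun hb => hx ?_) k hk
    simp [ha, hb]
  · exact hs.2 x ha k hk

/-- The product `(h ∘ σ^(k-1)) ⋯ (h ∘ σ) h`. -/
def orbitProd (σ : X ≃ₜ X) (h : C(X, ℂ)) : ℕ → C(X, ℂ)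
  | 0 => 1
  | k + 1 => shift σ k h * orbitProd σ h k

theorem orbitProd_ne_zero {h : C(X, ℂ)} {k : ℕ} {x : X}
    (hx : ∀ j < k, h ((σ ^ (j : ℤ)) x) ≠ 0) : orbitProd σ h k x ≠ 0 := by
  induction k with
  | zero => simp [orbitProd]
  | succ k ih =>
    exact mul_ne_zero (hx k k.lt_succ_self) (ih fun j hj => hx j (hj.trans k.lt_succ_self))

theorem Homog.pow (hs : P.Homog Y 1 a s) (k : ℕ) : P.Homog Y k (orbitProd σ a k) (s ^ k) := by
  induction k with
  | zero => simpa [orbitProd] using P.homog_one Y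
  | succ k ih =>
    rw [pow_succ', Nat.cast_succ, add_comm]
    exact hs.mul ih

end CovariantPair

/-! ### Irreducible representations -/

/-- A closed `*`-subalgebra of `C(X)` is closed under continuous functions of its real elements. -/
theorem comp_mem_of_isClosed {X : Type*} [TopologicalSpace X] [CompactSpace X]
    {C : StarSubalgebra ℂ C(X, ℂ)} (hC : IsClosed (C : Set C(X, ℂ))) (F : C(ℝ, ℝ)) {e : C(X, ℝ)}
    (he : e.realToRCLike ℂ ∈ C) : (F.comp e).realToRCLike ℂ ∈ C := by
  rw [← SetLike.mem_coe, ← hC.closure_eq, Metric.mem_closure_iff]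
  intro ε hε
  obtain ⟨p, hp⟩ := exists_polynomial_near_of_continuousOn (-‖e‖) ‖e‖ F F.continuous.continuousOn
    (ε / 2) (half_pos hε)
  refine ⟨Polynomial.aeval (e.realToRCLike ℂ) (p.map (algebraMap ℝ ℂ)),
    Algebra.adjoin_le (S := C.toSubalgebra) (Set.singleton_subset_iff.mpr he)
      (Polynomial.aeval_mem_adjoin_singleton _ _), ?_⟩
  rw [dist_comm, dist_eq_norm]
  refine lt_of_le_of_lt ((ContinuousMap.norm_le _ (half_pos hε).le).mpr fun x => ?_) (half_lt_self hε)
  have h1 : e x ∈ Set.Icc (-‖e‖) ‖e‖ := abs_le.mp (e.norm_coe_le_norm x)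
  have h2 : (Polynomial.aeval (e.realToRCLike ℂ) (p.map (algebraMap ℝ ℂ))) x
      = ((p.eval (e x) : ℝ) : ℂ) := by
    rw [← ContinuousMap.evalAlgHom_apply (S := ℂ), ← Polynomial.aeval_algHom_apply,
      Polynomial.aeval_map_algebraMap]
    change Polynomial.aeval (algebraMap ℝ ℂ (e x)) p = algebraMap ℝ ℂ (p.eval (e x))
    rw [Polynomial.aeval_algebraMap_apply, Polynomial.coe_aeval_eq_eval]
  rw [ContinuousMap.sub_apply, h2]
  change ‖((p.eval (e x) : ℝ) : ℂ) - ((F (e x) : ℝ) : ℂ)‖ ≤ _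
  rw [← Complex.ofReal_sub, Complex.norm_real]
  exact (hp _ h1).le

namespace IrrRep

variable {A : Type u} [CStarAlgebra A] {S : StarSubalgebra ℂ A}

theorem norm_apply_le [IsClosed (S : Set A)] (ρ : IrrRep S) (s : S) : ‖ρ.π s‖ ≤ ‖s‖ :=
  NonUnitalStarAlgHom.norm_apply_le ρ.π s

theorem mul_apply (ρ : IrrRep S) (s t : S) (v : ρ.H) : ρ.π (s * t) v = ρ.π s (ρ.π t v) := by
  rw [map_mul]; rfl

theorem inner_apply (ρ : IrrRep S) (s : S) (v w : ρ.H) :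
    ⟪ρ.π s v, w⟫_ℂ = ⟪v, ρ.π (star s) w⟫_ℂ := by
  rw [map_star, ContinuousLinearMap.star_eq_adjoint, ContinuousLinearMap.adjoint_inner_right]

theorem π_one (ρ : IrrRep S) : ρ.π 1 = 1 := by
  let K : Submodule ℂ ρ.H := LinearMap.eqLocus (ρ.π 1 : ρ.H →L[ℂ] ρ.H).toLinearMap LinearMap.id
  have hK : ∀ a v, ρ.π a v ∈ K := fun a v => by
    change ρ.π 1 (ρ.π a v) = ρ.π a v
    rw [← ρ.mul_apply, one_mul]
  rcases ρ.irreducible K (isClosed_eq (ρ.π 1).continuous continuous_id) fun a v _ => hK a v with h | h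
  · exact absurd (by ext a v; simpa [h] using hK a v) ρ.ne_zero
  · ext v
    exact (h ▸ Submodule.mem_top : v ∈ K)

theorem eq_zero_of_inner (ρ : IrrRep S) {v w : ρ.H} (hv : v ≠ 0)
    (h : ∀ s : S, ⟪ρ.π s v, w⟫_ℂ = 0) : w = 0 := by
  let K : Submodule ℂ ρ.H := ⨅ s : S, (ℂ ∙ ρ.π s v)ᗮ
  have hK : ∀ w, w ∈ K ↔ ∀ s : S, ⟪ρ.π s v, w⟫_ℂ = 0 := fun w => by
    simp [K, Submodule.mem_iInf, Submodule.mem_orthogonal_singleton_iff_inner_right]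
  have hKc : IsClosed (K : Set ρ.H) := by
    simp only [K, Submodule.coe_iInf]
    exact isClosed_iInter fun s => Submodule.isClosed_orthogonal _
  rcases ρ.irreducible K hKc fun a u hu => (hK _).mpr fun s => by
    have := (hK u).mp hu (star a * s)
    rwa [ρ.mul_apply, inner_apply, star_star] at this with h' | h'
  · simpa [h'] using (hK w).mpr h
  · have h1 := (hK v).mp (h' ▸ Submodule.mem_top) 1
    rw [ρ.π_one] at h1
    exact absurd (inner_self_eq_zero.mp h1) hv

end IrrRep

/-! ### Bottom vectors and the point attached to them -/

namespace IrrRep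

variable {X : Type*} [TopologicalSpace X] {σ : X ≃ₜ X} {A : Type u} [CStarAlgebra A]
  {P : CovariantPair σ A} {Y : Set X} {S : StarSubalgebra ℂ A} (ρ : IrrRep S)

/-- The vector `v` is annihilated by the adjoints of the homogeneous elements of positive
degree. -/
def IsBottom (P : CovariantPair σ A) (Y : Set X) (v : ρ.H) : Prop :=
  ∀ n : ℤ, 0 < n → ∀ (a : C(X, ℂ)) (s : S), P.Homog Y n a s → ρ.π (star s) v = 0

variable {ρ}

theorem IsBottom.apply_eq_zero {v : ρ.H} (hv : ρ.IsBottom P Y v) {n : ℤ} (hn : n < 0)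
    {a : C(X, ℂ)} {s : S} (hs : P.Homog Y n a s) : ρ.π s v = 0 := by
  have := hv (-n) (by omega) _ (star s) hs.star
  rwa [star_star] at this

theorem IsBottom.inner_eq_zero {v w : ρ.H} (hv : ρ.IsBottom P Y v) (hw : ρ.IsBottom P Y w)
    {n : ℤ} (hn : n ≠ 0) {a : C(X, ℂ)} {s : S} (hs : P.Homog Y n a s) : ⟪ρ.π s v, w⟫_ℂ = 0 := by
  rcases lt_or_gt_of_ne hn with h | h
  · rw [hv.apply_eq_zero h hs, inner_zero_left]
  · rw [inner_apply, hw n h a s hs, inner_zero_right]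

theorem IsBottom.apply {v : ρ.H} (hv : ρ.IsBottom P Y v) {c : C(X, ℂ)} {s : S}
    (hs : P.Homog Y 0 c s) : ρ.IsBottom P Y (ρ.π s v) := by
  intro n hn a t ht
  have h := hv (-0 + n) (by omega) _ (star s * t) (hs.star.mul ht)
  rwa [star_mul, star_star, mul_apply] at h

/-- Among the degrees `n` in which some adjoint `s*` acts nontrivially, take the largest. Any
nonzero `s* v` is then a bottom vector, since applying `t*` to it with `t` of positive degree gives
`(s t)* v`, of too large a degree. -/
theorem exists_isBottom (ρ : IrrRep S) {N : ℕ} (hN : ∀ n : ℤ, N ≤ n → ∀ a, Linked σ Y n a → a = 0) :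
    ∃ v : ρ.H, v ≠ 0 ∧ ρ.IsBottom P Y v := by
  classical
  let Q : ℕ → Prop := fun n => ∃ (a : C(X, ℂ)) (s : S), P.Homog Y n a s ∧ ρ.π (star s) ≠ 0
  have hQN : ∀ n, Q n → n ≤ N := by
    rintro n ⟨a, s, hs, hne⟩
    by_contra! hlt
    have ha : a = 0 := hN n (by exact_mod_cast hlt.le) a hs.2
    have : s = 0 := Subtype.ext (by rw [hs.1, ha, _root_.map_zero, mul_zero]; rfl)
    exact hne (by rw [this, star_zero, _root_.map_zero])
  have hQ0 : Q 0 := by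
    refine ⟨1, 1, P.homog_one Y, ?_⟩
    rw [star_one, π_one]
    intro h
    apply ρ.ne_zero
    ext a v
    have : (1 : ρ.H →L[ℂ] ρ.H) (ρ.π a v) = 0 := by rw [h]; rfl
    exact this
  obtain ⟨a, s, hs, hne⟩ := Nat.findGreatest_spec (P := Q) (hQN 0 hQ0) hQ0
  have hmax : ∀ m, Q m → m ≤ Nat.findGreatest Q N := fun m hm =>
    Nat.le_findGreatest (hQN m hm) hm
  generalize Nat.findGreatest Q N = n at hs hmax
  obtain ⟨v, hv⟩ : ∃ v, ρ.π (star s) v ≠ 0 := by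
    by_contra! h
    exact hne (ContinuousLinearMap.ext h)
  refine ⟨ρ.π (star s) v, hv, fun m hm b t ht => ?_⟩
  rw [← mul_apply, ← star_mul]
  by_contra hst
  lift m to ℕ using hm.le
  have := hmax (n + m) ⟨_, s * t, by push_cast; exact hs.mul ht, fun h => hst (by rw [h]; rfl)⟩
  omega

variable [IsClosed (S : Set A)]

/-- Two vectors are orthogonal to each other under the action of `S` if they are so under the
homogeneous elements. -/
theorem inner_eq_zero_of_homog {v w : ρ.H}
    (hS : Dense (Submodule.span ℂ {s : S | ∃ n a, P.Homog Y n a s} : Set S))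
    (h : ∀ n a (s : S), P.Homog Y n a s → ⟪ρ.π s v, w⟫_ℂ = 0) (s : S) : ⟪ρ.π s v, w⟫_ℂ = 0 := by
  have hc : Continuous ρ.π := AddMonoidHomClass.continuous_of_bound ρ.π 1 fun a => by
    simpa using ρ.norm_apply_le a
  have hcl : IsClosed {s : S | ⟪ρ.π s v, w⟫_ℂ = 0} :=
    isClosed_eq (((ContinuousLinearMap.apply ℂ ρ.H v).continuous.comp hc).inner continuous_const)
      continuous_const
  refine hcl.closure_subset_iff.mpr ?_ (hS s)
  intro t ht
  induction ht using Submodule.span_induction with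
  | mem t ht =>
    obtain ⟨n, a, hs⟩ := ht
    exact h n a t hs
  | zero => simp
  | add x y _ _ hx hy =>
    simp only [Set.mem_ofPred_eq] at hx hy ⊢
    rw [map_add, add_apply, inner_add_left, hx, hy, add_zero]
  | smul z x _ hx =>
    simp only [Set.mem_ofPred_eq] at hx ⊢
    rw [map_smul, smul_apply, inner_smul_left, hx, mul_zero]

/-- The elements of `S` of degree zero act on the bottom vectors without zero divisors. -/
theorem exists_isBottom_mul
    (hS : Dense (Submodule.span ℂ {s : S | ∃ n a, P.Homog Y n a s} : Set S))
    {c₁ c₂ : C(X, ℂ)} {s₁ s₂ : S} (h₁ : P.Homog Y 0 c₁ s₁) (h₂ : P.Homog Y 0 c₂ s₂)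
    (hk₁ : ∃ v, ρ.IsBottom P Y v ∧ ρ.π s₁ v ≠ 0) (hk₂ : ∃ v, ρ.IsBottom P Y v ∧ ρ.π s₂ v ≠ 0) :
    ∃ v, ρ.IsBottom P Y v ∧ ρ.π (s₁ * s₂) v ≠ 0 := by
  obtain ⟨v₁, hv₁, hne₁⟩ := hk₁
  obtain ⟨v₂, hv₂, hne₂⟩ := hk₂
  by_contra! hzero
  have hst : P.Homog Y 0 _ (star s₁) := h₁.star
  refine hne₁ (inner_self_eq_zero (𝕜 := ℂ).mp ?_)
  rw [inner_apply]
  suffices ρ.π (star s₁) (ρ.π s₁ v₁) = 0 by rw [this, inner_zero_right]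
  -- The vector `s₁* s₁ v₁` is orthogonal to the cyclic subspace of `s₂ v₂`: in nonzero degree
  -- because both vectors are bottom, in degree zero because `C(X)` is commutative and `s₁ s₂` kills
  -- `v₂`.
  refine ρ.eq_zero_of_inner hne₂ (inner_eq_zero_of_homog hS fun n a t ht => ?_)
  by_cases hn : n = 0
  · subst hn
    have hcomm : s₁ * (t * s₂) = t * (s₁ * s₂) := by
      apply Subtype.ext
      simp only [MulMemClass.coe_mul, h₁.eq_zero, h₂.eq_zero, ht.eq_zero, ← map_mul]
      congr 1
      ring
    rw [← inner_apply, ← ρ.mul_apply t, ← mul_apply, hcomm, mul_apply, hzero v₂ hv₂, map_zero,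
      inner_zero_left]
  · exact IsBottom.inner_eq_zero (hv₂.apply h₂) ((hv₁.apply h₁).apply hst) hn ht

/-- Iterating the absence of zero divisors, the product still acts nontrivially on some bottom
vector, so its symbol is not zero. -/
theorem exists_isBottom_prod
    (hS : Dense (Submodule.span ℂ {s : S | ∃ n a, P.Homog Y n a s} : Set S))
    (hv : ∃ v, v ≠ 0 ∧ ρ.IsBottom P Y v) {κ : Type*} (t : Finset κ) (c : κ → C(X, ℂ)) (s : κ → S)
    (h : ∀ k, P.Homog Y 0 (c k) (s k)) (hk : ∀ k, ∃ v, ρ.IsBottom P Y v ∧ ρ.π (s k) v ≠ 0) :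
    ∏ k ∈ t, c k ≠ 0 := by
  classical
  suffices ∃ z : S, P.Homog Y 0 (∏ k ∈ t, c k) z ∧ ∃ v, ρ.IsBottom P Y v ∧ ρ.π z v ≠ 0 by
    obtain ⟨z, hz, v, -, hzv⟩ := this
    intro h0
    refine hzv ?_
    have : z = 0 := Subtype.ext (by rw [hz.eq_zero, h0, map_zero]; rfl)
    rw [this, map_zero]; rfl
  induction t using Finset.induction_on with
  | empty =>
    obtain ⟨v, hv0, hv⟩ := hv
    exact ⟨1, P.homog_one Y, v, hv, by rwa [π_one]⟩
  | insert k t hkt ih =>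
    obtain ⟨z, hz, hzv⟩ := ih
    refine ⟨s k * z, ?_, exists_isBottom_mul hS (h k) hz (hk k) hzv⟩
    rw [Finset.prod_insert hkt]
    exact (h k).mul hz

/-- The elements of `S` of degree zero act on the bottom vectors by evaluation at a point. -/
theorem exists_point [CompactSpace X]
    (hS : Dense (Submodule.span ℂ {s : S | ∃ n a, P.Homog Y n a s} : Set S))
    (hv : ∃ v, v ≠ 0 ∧ ρ.IsBottom P Y v) :
    ∃ x : X, ∀ v, ρ.IsBottom P Y v → ∀ (c : C(X, ℂ)) (s : S), P.Homog Y 0 c s →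
      ρ.π s v = c x • v := by
  by_contra! hcon
  let C : StarSubalgebra ℂ C(X, ℂ) := S.comap P.π
  have hπc : Continuous P.π := AddMonoidHomClass.continuous_of_bound P.π 1 fun a => by
    simpa using NonUnitalStarAlgHom.norm_apply_le P.π a
  have hC : IsClosed (C : Set C(X, ℂ)) :=
    ‹IsClosed (S : Set A)›.preimage hπc
  -- If no point works, each `x` has a symbol that acts nontrivially on bottom vectors but vanishes
  -- near `x`. By compactness a finite product of these vanishes identically, against
  -- `exists_isBottom_prod`.
  have key : ∀ x : X, ∃ (c : C(X, ℂ)) (s : S), P.Homog Y 0 c s ∧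
      (∃ v, ρ.IsBottom P Y v ∧ ρ.π s v ≠ 0) ∧ c =ᶠ[𝓝 x] 0 := by
    intro x
    obtain ⟨v, hv, c, s, hs, hne⟩ := hcon x
    let c' : C(X, ℂ) := c - c x • 1
    let s' : S := s - c x • 1
    have hs' : P.Homog Y 0 c' s' := hs.sub_smul (P.homog_one Y) (c x)
    have hne' : ρ.π s' v ≠ 0 := by
      simp only [s', map_sub, map_smul, π_one, sub_apply,
        smul_apply, one_apply_eq_self]
      exact sub_ne_zero.mpr hne
    let e : C(X, ℝ) := ⟨fun z => Complex.normSq (c' z), by fun_prop⟩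
    have he : e.realToRCLike ℂ = star c' * c' := by
      ext z
      simp [e, Complex.normSq_eq_conj_mul_self]
    have heC : e.realToRCLike ℂ ∈ C := by
      have : c' ∈ C := by
        change P.π c' ∈ S
        rw [← hs'.eq_zero]
        exact s'.2
      rw [he]
      exact mul_mem (star_mem this) this
    have hval : ∀ f (hf : f ∈ C), P.Homog Y 0 f (⟨P.π f, hf⟩ : S) := fun f hf => P.homog_zero Y f
    let E : S := ⟨P.π (e.realToRCLike ℂ), heC⟩
    have hev : ρ.π E v ≠ 0 := by
      intro h0
      refine hne' (inner_self_eq_zero (𝕜 := ℂ).mp ?_)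
      have : E = star s' * s' := by
        apply Subtype.ext
        simp only [E, he, map_mul, map_star, MulMemClass.coe_mul, StarMemClass.coe_star,
          hs'.eq_zero]
      rw [inner_apply, ← mul_apply, ← this, h0, inner_zero_right]
    -- Cutting `e = |c - c(x)|²` off at `δ` makes it vanish near `x` and moves it by at most `δ` in
    -- norm, too little to kill `v`.
    obtain ⟨δ, hδ, hδv⟩ := exists_pos_mul_lt (norm_pos_iff.mpr hev) ‖v‖
    let F : C(ℝ, ℝ) := ⟨fun r => max (r - δ) 0, by fun_prop⟩
    have hFC := comp_mem_of_isClosed hC F heC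
    let D : S := ⟨P.π ((F.comp e).realToRCLike ℂ), hFC⟩
    refine ⟨_, D, hval _ hFC, ⟨v, hv, fun h0 => ?_⟩, ?_⟩
    · have h1 : ρ.π (E - D) v = ρ.π E v := by
        rw [map_sub, sub_apply, h0, sub_zero]
      have h2 : ‖E - D‖ ≤ δ := by
        change ‖P.π (e.realToRCLike ℂ) - P.π ((F.comp e).realToRCLike ℂ)‖ ≤ δ
        rw [← map_sub]
        refine (NonUnitalStarAlgHom.norm_apply_le P.π _).trans
          ((ContinuousMap.norm_le _ hδ.le).mpr fun z => ?_)
        change ‖((e z : ℝ) : ℂ) - ((max (e z - δ) 0 : ℝ) : ℂ)‖ ≤ δ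
        rw [← Complex.ofReal_sub, Complex.norm_real, Real.norm_eq_abs, abs_le]
        have : 0 ≤ e z := Complex.normSq_nonneg _
        rcases max_cases (e z - δ) 0 with h | h <;> constructor <;> linarith [h.1, h.2]
      have h3 := (ContinuousLinearMap.le_opNorm (ρ.π (E - D)) v).trans
        (mul_le_mul_of_nonneg_right ((ρ.norm_apply_le _).trans h2) (norm_nonneg v))
      rw [h1] at h3
      linarith
    · have hx : e x < δ := by simpa [e, c'] using hδ
      filter_upwards [(isOpen_lt e.continuous continuous_const).mem_nhds hx] with z hz
      have hz' : e z < δ := hz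
      change ((max (e z - δ) 0 : ℝ) : ℂ) = 0
      rw [max_eq_right (by linarith), Complex.ofReal_zero]
  choose c s hs hsv hc using key
  obtain ⟨t, -, ht⟩ := isCompact_univ.elim_nhds_subcover (fun x => {z | c x z = 0}) fun x _ => hc x
  refine exists_isBottom_prod hS hv t c s hs hsv ?_
  ext z
  have hz := ht (Set.mem_univ z)
  simp only [Set.mem_iUnion, Set.mem_ofPred_eq, exists_prop] at hz
  obtain ⟨x, hx, hxz⟩ := hz
  rw [ContinuousMap.coe_prod, Finset.prod_apply]
  exact Finset.prod_eq_zero hx hxz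

end IrrRep

/-! ### The orbit segment of an irreducible representation -/

namespace IrrRep

variable {X : Type*} [TopologicalSpace X] {σ : X ≃ₜ X} {A : Type u} [CStarAlgebra A]
  {P : CovariantPair σ A} {Y : Set X} {S : StarSubalgebra ℂ A}

/-- The representation `ρ` is, in the orthonormal basis `b`, the representation attached to the
orbit segment `x, σ x, …, σ^δ x`, on which `T = u h` acts by a weighted shift. -/
structure IsOrbitBasis (P : CovariantPair σ A) (h : C(X, ℝ)) (T : S) (ρ : IrrRep S) (x : X) {δ : ℕ}
    (b : OrthonormalBasis (Fin (δ + 1)) ℂ ρ.H) : Prop where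
  pred_eq_zero : h ((σ ^ (-1 : ℤ)) x) = 0
  last_eq_zero : h ((σ ^ (δ : ℤ)) x) = 0
  ne_zero : ∀ k < δ, h ((σ ^ (k : ℤ)) x) ≠ 0
  apply_fun : ∀ (c : C(X, ℂ)) (s : S), (s : A) = P.π c → ∀ k : Fin (δ + 1),
    ρ.π s (b k) = c ((σ ^ ((k : ℕ) : ℤ)) x) • b k
  apply_castSucc : ∀ k : Fin δ,
    ρ.π T (b k.castSucc) = (h ((σ ^ ((k : ℕ) : ℤ)) x) : ℂ) • b k.succ
  apply_last : ρ.π T (b (Fin.last δ)) = 0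

section

variable [IsClosed (S : Set A)] {ρ : IrrRep S} {v : ρ.H} {x : X}

/-- The element `s* s` has degree zero and symbol `|a|²`, so `‖s v‖² = |a(x)|² ‖v‖²`. -/
theorem apply_eq_zero_of_point
    (hx : ∀ (c : C(X, ℂ)) (s : S), P.Homog Y 0 c s → ρ.π s v = c x • v)
    {n : ℤ} {a : C(X, ℂ)} {s : S} (hs : P.Homog Y n a s) (ha : a x = 0) : ρ.π s v = 0 := by
  refine inner_self_eq_zero (𝕜 := ℂ).mp ?_
  have h : P.Homog Y (-n + n) _ ((star s * s : S) : A) := hs.star.mul hs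
  rw [neg_add_cancel] at h
  rw [inner_apply, ← mul_apply, hx _ _ h, ContinuousMap.mul_apply, ha, mul_zero, zero_smul,
    inner_zero_right]

theorem apply_eq_of_point
    (hx : ∀ (c : C(X, ℂ)) (s : S), P.Homog Y 0 c s → ρ.π s v = c x • v)
    {n : ℤ} {a b : C(X, ℂ)} {s t : S} (hs : P.Homog Y n a s) (ht : P.Homog Y n b t)
    (hb : b x ≠ 0) : ρ.π s v = a x • (b x)⁻¹ • ρ.π t v := by
  have h : P.Homog Y n _ ((s - (a x * (b x)⁻¹) • t : S) : A) := hs.sub_smul ht _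
  have h0 := apply_eq_zero_of_point hx h (by simp [hb])
  rwa [map_sub, sub_apply, sub_eq_zero, map_smul, smul_apply, mul_smul] at h0

end

/-- Let `δ` be the first time the orbit of `x` meets `Y`. In each degree up to `δ` all elements send
the bottom vector `v` to multiples of `T^k v`; in other degrees they kill it. The normalized `T^k v`
thus span an invariant subspace, which is everything by irreducibility. -/
theorem exists_isOrbitBasis [CompactSpace X] [IsClosed (S : Set A)] (ρ : IrrRep S)
    (hS : Dense (Submodule.span ℂ {s : S | ∃ n a, P.Homog Y n a s} : Set S))
    {h : C(X, ℝ)} (hY : ∀ x, x ∈ Y ↔ h x = 0) {T : S} (hT : (T : A) = P.U * P.π (h.realToRCLike ℂ))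
    {N : ℕ} (hN : ∀ x, ∃ k < N, (σ ^ (k : ℤ)) x ∈ Y) :
    ∃ (x : X) (δ : ℕ) (b : OrthonormalBasis (Fin (δ + 1)) ℂ ρ.H), IsOrbitBasis P h T ρ x b := by
  classical
  have hN' : ∀ n : ℤ, N ≤ n → ∀ a, Linked σ Y n a → a = 0 := by
    intro n hn a ha
    ext x
    obtain ⟨k, hk, hkY⟩ := hN x
    by_contra hne
    exact ha x hne k (by omega) hkY
  obtain ⟨x, hx⟩ := exists_point hS (ρ.exists_isBottom hN')
  obtain ⟨v, hv0, hv⟩ : ∃ v : ρ.H, ‖v‖ = 1 ∧ ρ.IsBottom P Y v := by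
    obtain ⟨v, hv0, hv⟩ := ρ.exists_isBottom hN'
    refine ⟨(‖v‖ : ℂ)⁻¹ • v, ?_, fun n hn a s hs => ?_⟩
    · simp [norm_smul, hv0]
    · rw [map_smul, hv n hn a s hs, smul_zero]
  replace hx := hx v hv
  have hTh : P.Homog Y 1 (h.realToRCLike ℂ) T := by
    refine ⟨by simpa using hT, fun z hz k hk => ?_⟩
    obtain rfl : k = 0 := by omega
    intro hzY
    refine hz ?_
    change ((h z : ℝ) : ℂ) = 0
    rw [(hY z).mp hzY, Complex.ofReal_zero]
  let p : ℕ → C(X, ℂ) := CovariantPair.orbitProd σ (h.realToRCLike ℂ)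
  have hTk : ∀ k : ℕ, P.Homog Y k (p k) ((T ^ k : S) : A) := fun k => hTh.pow k
  let δ := Nat.find (hN x |>.imp fun k hk => hk.2)
  have hδ : (σ ^ (δ : ℤ)) x ∈ Y := Nat.find_spec (hN x |>.imp fun k hk => hk.2)
  have hδk : ∀ k < δ, (σ ^ (k : ℤ)) x ∉ Y := fun k hk => Nat.find_min _ hk
  clear_value δ
  have hne : ∀ k < δ, h ((σ ^ (k : ℤ)) x) ≠ 0 := fun k hk h0 => hδk k hk ((hY _).mpr h0)
  have hp : ∀ k ≤ δ, p k x ≠ 0 := fun k hk => CovariantPair.orbitProd_ne_zero fun j hj => by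
    simpa using hne j (hj.trans_le hk)
  let e : ℕ → ρ.H := fun k => (p k x)⁻¹ • ρ.π (T ^ k) v
  have hA : ∀ k : ℕ, k ≤ δ → ∀ (n : ℤ) a (s : S), n = k → P.Homog Y n a s → ρ.π s v = a x • e k := by
    rintro k hk _ a s rfl hs
    exact apply_eq_of_point hx hs (hTk k) (hp k hk)
  -- An orbit segment of length `n > δ` from `x` passes through `Y`, so the coefficient vanishes at
  -- `x`.
  have hB : ∀ n : ℤ, δ < n → ∀ a (s : S), P.Homog Y n a s → ρ.π s v = 0 := by
    intro n hn a s hs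
    refine apply_eq_zero_of_point hx hs ?_
    by_contra hne
    exact hs.2 x hne δ (by omega) hδ
  have hse : ∀ k : ℕ, ∀ (n : ℤ) a (s : S), P.Homog Y n a s →
      ρ.π s (e k) = (p k x)⁻¹ • ρ.π (s * T ^ k) v := by
    intro k n a s hs
    simp only [e, map_smul, mul_apply]
  have hfun : ∀ (c : C(X, ℂ)) (s : S), (s : A) = P.π c → ∀ k ≤ δ,
      ρ.π s (e k) = c ((σ ^ (k : ℤ)) x) • e k := by
    intro c s hs k hk
    have hsc : P.Homog Y 0 c s := hs ▸ P.homog_zero Y c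
    rw [hse k _ _ _ hsc, hA k hk _ _ _ (zero_add _) (hsc.mul (hTk k)), smul_smul,
      ContinuousMap.mul_apply, shift_apply, mul_comm, mul_assoc, mul_inv_cancel₀ (hp k hk), mul_one]
  have hTe : ∀ k < δ, ρ.π T (e k) = (h ((σ ^ (k : ℤ)) x) : ℂ) • e (k + 1) := by
    intro k hk
    rw [hse k _ _ _ hTh, hA (k + 1) hk _ _ _ (by push_cast; ring) (hTh.mul (hTk k)), smul_smul,
      ContinuousMap.mul_apply, shift_apply, mul_comm, mul_assoc, mul_inv_cancel₀ (hp k hk.le),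
      mul_one]
    rfl
  have hTl : ρ.π T (e δ) = 0 := by
    rw [hse δ _ _ _ hTh, hB _ (by omega) _ _ (hTh.mul (hTk δ)), smul_zero]
  have horth : Orthonormal ℂ fun k : Fin (δ + 1) => e k := by
    rw [orthonormal_iff_ite]
    intro k l
    simp only [e, inner_smul_left, inner_smul_right]
    rw [inner_apply, ← mul_apply, ← inner_conj_symm]
    have hst : P.Homog Y (-k + l) _ ((star (T ^ (k : ℕ)) * T ^ (l : ℕ) : S) : A) :=
      (hTk k).star.mul (hTk l)
    split_ifs with hkl
    · subst hkl
      rw [neg_add_cancel] at hst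
      have hk := hp k (Nat.lt_succ_iff.mp k.2)
      have hσ : (σ ^ (-((k : ℕ) : ℤ))) ((σ ^ ((k : ℕ) : ℤ)) x) = x := by
        rw [← Homeomorph.zpow_add_apply, neg_add_cancel]; rfl
      rw [hx _ _ hst, inner_conj_symm, inner_smul_right, inner_self_eq_norm_sq_to_K, hv0,
        ContinuousMap.mul_apply, shift_apply, shift_apply, hσ, ContinuousMap.star_apply, map_inv₀]
      have hk' : (starRingEnd ℂ) (p k x) ≠ 0 := (map_ne_zero _).mpr hk
      change _ * (_ * ((starRingEnd ℂ) (p k x) * _ * _)) = _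
      field_simp
      simp
    · have hkl' : -((k : ℕ) : ℤ) + (l : ℕ) ≠ 0 := fun h0 => hkl (Fin.ext (by omega))
      rw [hv.inner_eq_zero hv hkl' hst, _root_.map_zero, mul_zero, mul_zero]
  have he0 : e 0 = v := by
    simp [e, p, CovariantPair.orbitProd, π_one]
  have hspan : (⊤ : Submodule ℂ ρ.H) ≤ Submodule.span ℂ (Set.range fun k : Fin (δ + 1) => e k) := by
    set L := Submodule.span ℂ (Set.range fun k : Fin (δ + 1) => e k) with hL
    have : FiniteDimensional ℂ L := FiniteDimensional.span_of_finite ℂ (Set.finite_range _)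
    have heL : ∀ k ≤ δ, e k ∈ L := fun k hk => Submodule.subset_span ⟨⟨k, by omega⟩, rfl⟩
    have hhom : ∀ n a (s : S), P.Homog Y n a s → ∀ w ∈ L, ρ.π s w ∈ L := by
      intro n a s hs w hw
      induction hw using Submodule.span_induction with
      | mem w hw =>
        obtain ⟨k, rfl⟩ := hw
        simp only
        rw [hse k n a s hs]
        refine L.smul_mem _ ?_
        have hst : P.Homog Y (n + (k : ℕ)) _ ((s * T ^ (k : ℕ) : S) : A) := hs.mul (hTk k)
        rcases lt_or_ge (n + (k : ℕ)) 0 with hneg | hpos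
        · rw [hv.apply_eq_zero hneg hst]
          exact L.zero_mem
        · rcases lt_or_ge (δ : ℤ) (n + (k : ℕ)) with hlt | hle
          · rw [hB _ hlt _ _ hst]
            exact L.zero_mem
          · rw [hA (n + (k : ℕ)).toNat (by omega) _ _ _ (by omega) hst]
            exact L.smul_mem _ (heL _ (by omega))
      | zero => simp
      | add w w' _ _ hw hw' =>
        rw [map_add]
        exact L.add_mem hw hw'
      | smul z w _ hw =>
        rw [map_smul]
        exact L.smul_mem _ hw
    -- Invariance passes from homogeneous elements to `S` by density, tested against the orthogonal
    -- complement of `L`.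
    have hinv : ∀ s : S, ∀ w ∈ L, ρ.π s w ∈ L := by
      intro s w hw
      rw [← L.orthogonal_orthogonal, Submodule.mem_orthogonal']
      intro z hz
      refine inner_eq_zero_of_homog hS (fun n a t ht => ?_) s
      exact Submodule.inner_right_of_mem_orthogonal (hhom n a t ht w hw) hz
    rcases ρ.irreducible L L.closed_of_finiteDimensional hinv with hbot | htop
    · have : v ∈ L := he0 ▸ heL 0 (Nat.zero_le _)
      rw [hbot, Submodule.mem_bot] at this
      simp [this] at hv0
    · exact htop.ge
  refine ⟨x, δ, OrthonormalBasis.mk horth hspan, ?_, (hY _).mp hδ, hne, ?_, ?_, ?_⟩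
  -- As `v` is a bottom vector, `T* v = 0`. The element `T T*` has degree zero and symbol `(h ∘
  -- σ⁻¹)²`, which must therefore vanish at `x`.
  · have h1 := hv 1 one_pos _ T hTh
    have hTT : P.Homog Y (1 + -1) _ ((T * star T : S) : A) := hTh.mul hTh.star
    rw [add_neg_cancel] at hTT
    have h2 := hx _ _ hTT
    rw [mul_apply, h1, _root_.map_zero] at h2
    have hv0' : v ≠ 0 := fun h0 => by simp [h0] at hv0
    have h3 := (smul_eq_zero.mp h2.symm).resolve_right hv0'
    rw [ContinuousMap.mul_apply, shift_apply, shift_apply, ContinuousMap.star_apply,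
      mul_eq_zero, star_eq_zero, or_self] at h3
    exact Complex.ofReal_eq_zero.mp h3
  · intro c s hs k
    simp only [OrthonormalBasis.coe_mk]
    exact hfun c s hs k (Nat.lt_succ_iff.mp k.2)
  · intro k
    simp only [OrthonormalBasis.coe_mk]
    exact hTe k k.2
  · simp only [OrthonormalBasis.coe_mk]
    exact hTl

end IrrRep

/-! ### The topology of the primitive ideals of a given dimension -/

namespace IrrRep

variable {X : Type*} [TopologicalSpace X] {σ : X ≃ₜ X} {A : Type u} [CStarAlgebra A]
  {P : CovariantPair σ A} {S : StarSubalgebra ℂ A}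

theorem IsOrbitBasis.apply_pow {h : C(X, ℝ)} {T : S} {ρ : IrrRep S} {x : X} {δ : ℕ}
    {b : OrthonormalBasis (Fin (δ + 1)) ℂ ρ.H} (hb : IsOrbitBasis P h T ρ x b) (j l : ℕ)
    (hl : l < δ + 1) :
    (∀ hlj : l + j < δ + 1, ∃ μ : ℂ, μ ≠ 0 ∧ ρ.π (T ^ j) (b ⟨l, hl⟩) = μ • b ⟨l + j, hlj⟩) ∧
      (δ + 1 ≤ l + j → ρ.π (T ^ j) (b ⟨l, hl⟩) = 0) := by
  induction j generalizing l with
  | zero =>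
    refine ⟨fun _ => ⟨1, one_ne_zero, by simp [π_one]⟩, fun _ => by omega⟩
  | succ j ih =>
    rw [pow_succ, mul_apply]
    rcases Nat.lt_succ_iff_lt_or_eq.mp hl with hlt | rfl
    · have h1 : ρ.π T (b ⟨l, hl⟩) = (h ((σ ^ (l : ℤ)) x) : ℂ) • b ⟨l + 1, by omega⟩ :=
        hb.apply_castSucc ⟨l, hlt⟩
      have h2 : (h ((σ ^ (l : ℤ)) x) : ℂ) ≠ 0 := Complex.ofReal_ne_zero.mpr (hb.ne_zero l hlt)
      obtain ⟨ih1, ih2⟩ := ih (l + 1) (by omega)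
      rw [h1, map_smul]
      refine ⟨fun hlj => ?_, fun hlj => by rw [ih2 (by omega), smul_zero]⟩
      obtain ⟨μ, hμ, hμe⟩ := ih1 (by omega)
      refine ⟨_ * μ, mul_ne_zero h2 hμ, ?_⟩
      rw [hμe, smul_smul]
      congr 3
      omega
    · refine ⟨fun hlj => by omega, fun _ => ?_⟩
      have : ρ.π T (b ⟨l, hl⟩) = 0 := hb.apply_last
      rw [this, _root_.map_zero]

/-- Since `T^δ` is nonzero only on the first basis vector, `T^k (T^δ)*` is a nonzero rank-one
operator onto the line of `b k`. Whether `c` vanishes at `σ^k x` is thus visible in the kernel of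
`ρ`. -/
theorem IsOrbitBasis.apply_mul_ne_zero_iff {h : C(X, ℝ)} {T : S} {ρ : IrrRep S} {x : X} {δ : ℕ}
    {b : OrthonormalBasis (Fin (δ + 1)) ℂ ρ.H} (hb : IsOrbitBasis P h T ρ x b) {c : C(X, ℂ)} {s : S}
    (hs : (s : A) = P.π c) (k : Fin (δ + 1)) :
    ρ.π (s * (T ^ (k : ℕ) * star (T ^ δ))) ≠ 0 ↔ c ((σ ^ ((k : ℕ) : ℤ)) x) ≠ 0 := by
  obtain ⟨μ, hμ, hμe⟩ := (hb.apply_pow δ 0 (Nat.succ_pos _)).1 (by omega)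
  obtain ⟨ν, hν, hνe⟩ := (hb.apply_pow k 0 (Nat.succ_pos _)).1 (by omega)
  have hkk : (⟨0 + (k : ℕ), by omega⟩ : Fin (δ + 1)) = k := Fin.ext (zero_add _)
  rw [hkk] at hνe
  have hstar : ∀ w, ρ.π (star (T ^ δ)) w
      = (starRingEnd ℂ μ * ⟪b ⟨0 + δ, by omega⟩, w⟫_ℂ) • b ⟨0, Nat.succ_pos _⟩ := by
    intro w
    rw [← b.sum_repr' (ρ.π (star (T ^ δ)) w), Finset.sum_eq_single ⟨0, Nat.succ_pos _⟩]
    · rw [← inner_apply, hμe, inner_smul_left]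
    · intro j _ hj
      have hj0 : (j : ℕ) ≠ 0 := fun h0 => hj (Fin.ext h0)
      rw [← inner_apply, (hb.apply_pow δ j j.2).2 (by omega), inner_zero_left, zero_smul]
    · simp
  have hall : ∀ w, ρ.π (s * (T ^ (k : ℕ) * star (T ^ δ))) w
      = (starRingEnd ℂ μ * ⟪b ⟨0 + δ, by omega⟩, w⟫_ℂ * ν * c ((σ ^ ((k : ℕ) : ℤ)) x)) • b k := by
    intro w
    rw [mul_apply, mul_apply, hstar, map_smul, map_smul, hνe, map_smul, hb.apply_fun c s hs k,
      smul_smul, smul_smul, mul_assoc]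
  rw [not_iff_not]
  constructor
  · intro h0
    have h1 := hall (b ⟨0 + δ, by omega⟩)
    rw [h0, zero_apply, inner_self_eq_norm_sq_to_K, b.norm_eq_one] at h1
    have h2 := (smul_eq_zero.mp h1.symm).resolve_right (b.orthonormal.ne_zero k)
    simpa [hμ, hν] using h2
  · intro h0
    ext w
    rw [hall, h0, mul_zero, zero_smul, zero_apply]

section Continuity

variable [IsClosed (S : Set A)] {Z : Type*} [TopologicalSpace Z] {ρ : Z → IrrRep S} {x : Z → X}
  {δ : ℕ} {b : ∀ z, OrthonormalBasis (Fin (δ + 1)) ℂ (ρ z).H} {κ : Type*} {ψ : κ → C(X, ℝ)}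
  {i₀ : κ} {T : S}

/-- The coordinates of the orbit segment depend continuously on the primitive ideal. -/
theorem continuous_coordinate [CompactSpace X]
    (hb : ∀ z, IsOrbitBasis P (ψ i₀) T (ρ z) (x z) (b z))
    (hψ : ∀ i, P.π ((ψ i).realToRCLike ℂ) ∈ S)
    (ho : ∀ s : S, IsOpen {z | (ρ z).π s ≠ 0}) (i : κ) (k : Fin (δ + 1)) :
    Continuous fun z => ψ i ((σ ^ ((k : ℕ) : ℤ)) (x z)) := by
  have hπc : Continuous P.π := AddMonoidHomClass.continuous_of_bound P.π 1 fun a => by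
    simpa using NonUnitalStarAlgHom.norm_apply_le P.π a
  have hC : IsClosed ((S.comap P.π : StarSubalgebra ℂ C(X, ℂ)) : Set C(X, ℂ)) :=
    ‹IsClosed (S : Set A)›.preimage hπc
  -- Half-lines are the nonvanishing sets of `max (r - t) 0` and `max (t - r) 0`, and `S` is closed
  -- under composing the generators with such functions.
  have key : ∀ F : C(ℝ, ℝ), IsOpen {z | F (ψ i ((σ ^ ((k : ℕ) : ℤ)) (x z))) ≠ 0} := by
    intro F
    have hF : P.π ((F.comp (ψ i)).realToRCLike ℂ) ∈ S :=
      comp_mem_of_isClosed (C := S.comap P.π) hC F (hψ i)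
    convert ho (⟨_, hF⟩ * (T ^ (k : ℕ) * star (T ^ δ))) using 3 with z
    rw [(hb z).apply_mul_ne_zero_iff rfl k]
    exact Complex.ofReal_ne_zero.symm
  rw [OrderTopology.continuous_iff]
  refine fun t => ⟨?_, ?_⟩
  · convert key ⟨fun r => max (r - t) 0, by fun_prop⟩ using 1
    ext z
    change t < _ ↔ max (_ - t) 0 ≠ 0
    rw [ne_eq, max_eq_right_iff, sub_nonpos, not_le]
  · convert key ⟨fun r => max (t - r) 0, by fun_prop⟩ using 1
    ext z
    change _ < t ↔ max (t - _) 0 ≠ 0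
    rw [ne_eq, max_eq_right_iff, sub_nonpos, not_le]

/-- The matrix coefficients of an element of `S` depend continuously on the coordinates of the
orbit segment. -/
theorem continuous_inner
    (hb : ∀ z, IsOrbitBasis P (ψ i₀) T (ρ z) (x z) (b z))
    (hS : S = (StarAlgebra.adjoin ℂ
      (Set.range (fun i => P.π ((ψ i).realToRCLike ℂ)) ∪ {(T : A)})).topologicalClosure)
    (hc : ∀ i (k : Fin (δ + 1)), Continuous fun z => ψ i ((σ ^ ((k : ℕ) : ℤ)) (x z)))
    (s : S) (k l : Fin (δ + 1)) : Continuous fun z => ⟪b z k, (ρ z).π s (b z l)⟫_ℂ := by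
  have hsub : StarAlgebra.adjoin ℂ
      (Set.range (fun i => P.π ((ψ i).realToRCLike ℂ)) ∪ {(T : A)}) ≤ S :=
    (StarSubalgebra.le_topologicalClosure _).trans hS.ge
  have hadj : ∀ a ∈ StarAlgebra.adjoin ℂ
      (Set.range (fun i => P.π ((ψ i).realToRCLike ℂ)) ∪ {(T : A)}), ∀ s : S, (s : A) = a →
      ∀ k l, Continuous fun z => ⟪b z k, (ρ z).π s (b z l)⟫_ℂ := by
    intro a ha
    induction ha using StarAlgebra.adjoin_induction with
    | mem a ha =>
      intro s hs k l
      rcases ha with ⟨i, rfl⟩ | rfl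
      · simp only [fun z => (hb z).apply_fun _ s hs l, inner_smul_right,
          fun z => orthonormal_iff_ite.mp (b z).orthonormal k l]
        exact (Complex.continuous_ofReal.comp (hc i l)).mul continuous_const
      · obtain rfl : s = T := Subtype.ext hs
        rcases Fin.eq_castSucc_or_eq_last l with ⟨l, rfl⟩ | rfl
        · simp only [fun z => (hb z).apply_castSucc l, inner_smul_right,
            fun z => orthonormal_iff_ite.mp (b z).orthonormal k l.succ]
          exact (Complex.continuous_ofReal.comp (hc i₀ l.castSucc)).mul continuous_const
        · simp only [fun z => (hb z).apply_last, inner_zero_right]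
          exact continuous_const
    | algebraMap r =>
      intro s hs k l
      obtain rfl : s = r • 1 := Subtype.ext (by rw [hs, Algebra.algebraMap_eq_smul_one]; rfl)
      simp only [map_smul, π_one, smul_apply, one_apply_eq_self, inner_smul_right,
        fun z => orthonormal_iff_ite.mp (b z).orthonormal k l]
      exact continuous_const
    | add a a' ha ha' iha iha' =>
      intro s hs k l
      obtain rfl : s = ⟨a, hsub ha⟩ + ⟨a', hsub ha'⟩ := Subtype.ext hs
      simp only [map_add, add_apply, inner_add_right]
      exact (iha ⟨a, hsub ha⟩ rfl k l).add (iha' ⟨a', hsub ha'⟩ rfl k l)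
    | mul a a' ha ha' iha iha' =>
      intro s hs k l
      obtain rfl : s = ⟨a, hsub ha⟩ * ⟨a', hsub ha'⟩ := Subtype.ext hs
      have : ∀ z, ⟪b z k, (ρ z).π (⟨a, hsub ha⟩ * ⟨a', hsub ha'⟩) (b z l)⟫_ℂ
          = ∑ j, ⟪b z j, (ρ z).π ⟨a', hsub ha'⟩ (b z l)⟫_ℂ
            * ⟪b z k, (ρ z).π ⟨a, hsub ha⟩ (b z j)⟫_ℂ := by
        intro z
        conv_lhs => rw [mul_apply, ← (b z).sum_repr' ((ρ z).π ⟨a', hsub ha'⟩ (b z l))]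
        simp only [map_sum, inner_sum, map_smul, inner_smul_right]
      simp only [this]
      exact continuous_finsetSum _ fun j _ =>
        (iha' ⟨a', hsub ha'⟩ rfl j l).mul (iha ⟨a, hsub ha⟩ rfl k j)
    | star a ha iha =>
      intro s hs k l
      obtain rfl : s = star ⟨a, hsub ha⟩ := Subtype.ext hs
      simp only [← inner_apply]
      simp only [← inner_conj_symm _ (b _ l)]
      exact Complex.continuous_conj.comp (iha ⟨a, hsub ha⟩ rfl l k)
  -- Matrix coefficients of `s` and of `a` differ by at most `‖s - a‖`, uniformly in `z`, so
  -- continuity passes to the closure.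
  refine continuous_of_uniform_approx_of_continuous fun u hu => ?_
  obtain ⟨ε, hε, hεu⟩ := Metric.mem_uniformity_dist.mp hu
  have hs : (s : A) ∈ closure (StarAlgebra.adjoin ℂ
      (Set.range (fun i => P.π ((ψ i).realToRCLike ℂ)) ∪ {(T : A)}) : Set A) := hS.le s.2
  obtain ⟨a, ha, hsa⟩ := Metric.mem_closure_iff.mp hs ε hε
  refine ⟨_, hadj a ha ⟨a, hsub ha⟩ rfl k l, fun z => hεu ?_⟩
  rw [dist_eq_norm, ← inner_sub_right, ← sub_apply, ← map_sub]
  refine ((norm_inner_le_norm _ _).trans ?_).trans_lt hsa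
  rw [(b z).norm_eq_one, one_mul]
  refine (ContinuousLinearMap.le_opNorm _ _).trans ?_
  rw [(b z).norm_eq_one, mul_one, dist_eq_norm]
  exact (ρ z).norm_apply_le _

end Continuity

theorem mem_ker_iff (ρ : IrrRep S) (s : S) : s ∈ ρ.ker ↔ ρ.π s = 0 :=
  TwoSidedIdeal.mem_ker _

/-- If all irreducible representations of `S` come from orbit segments, then `Prim_d(S)` has
dimension at most `d` times the number of generating functions. -/
theorem coveringDim_primOfDim_le [CompactSpace X] [IsClosed (S : Set A)] {κ : Type*} [Finite κ]
    {ψ : κ → C(X, ℝ)} {i₀ : κ} {T : S}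
    (hS : S = (StarAlgebra.adjoin ℂ
      (Set.range (fun i => P.π ((ψ i).realToRCLike ℂ)) ∪ {(T : A)})).topologicalClosure)
    (hρ : ∀ ρ : IrrRep S, ∃ (x : X) (δ : ℕ) (b : OrthonormalBasis (Fin (δ + 1)) ℂ ρ.H),
      IsOrbitBasis P (ψ i₀) T ρ x b) (d : ℕ) :
    CoveringDimLE (primOfDim S d) (Nat.card κ * d) := by
  have hex : ∀ z : primOfDim S d, ∃ (ρ : IrrRep S) (x : X) (δ : ℕ)
      (b : OrthonormalBasis (Fin (δ + 1)) ℂ ρ.H), d = δ + 1 ∧ ρ.ker = z.1.1 ∧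
      IsOrbitBasis P (ψ i₀) T ρ x b := by
    rintro ⟨z, ρ, hd, hz⟩
    obtain ⟨x, δ, b, hb⟩ := hρ ρ
    refine ⟨ρ, x, δ, b, ?_, hz, hb⟩
    rw [← hd.2, Module.finrank_eq_card_basis b.toBasis, Fintype.card_fin]
  rcases em (∃ δ, d = δ + 1) with ⟨δ, rfl⟩ | hd
  -- This is `d = 0`, where `Prim_d(S)` is empty.
  swap
  · intro ι _ V hV hVU
    have : IsEmpty (primOfDim S d) := ⟨fun z => by
      obtain ⟨-, -, δ, -, h, -⟩ := hex z
      exact hd ⟨δ, h⟩⟩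
    exact ⟨ι, inferInstance, V, hV, hVU, fun k => ⟨k, subset_rfl⟩, fun x => isEmptyElim x⟩
  have hex' : ∀ z : primOfDim S (δ + 1), ∃ (ρ : IrrRep S) (x : X)
      (b : OrthonormalBasis (Fin (δ + 1)) ℂ ρ.H), ρ.ker = z.1.1 ∧
      IsOrbitBasis P (ψ i₀) T ρ x b := by
    intro z
    obtain ⟨ρ, x, δ', b, h, hz, hb⟩ := hex z
    obtain rfl : δ = δ' := by omega
    exact ⟨ρ, x, b, hz, hb⟩
  choose ρ x b hz hb using hex'
  let Θ : primOfDim S (δ + 1) → κ × Fin (δ + 1) → ℝ :=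
    fun z ik => ψ ik.1 ((σ ^ ((ik.2 : ℕ) : ℤ)) (x z))
  have hmem : ∀ (s : S) z, s ∉ z.1.1 ↔ (ρ z).π s ≠ 0 := fun s z => by
    rw [← hz z, mem_ker_iff]
  have hψ : ∀ i, P.π ((ψ i).realToRCLike ℂ) ∈ S := fun i =>
    hS.ge (StarSubalgebra.le_topologicalClosure _ (StarAlgebra.subset_adjoin ℂ _ (Or.inl ⟨i, rfl⟩)))
  have hcont : Continuous Θ := by
    refine continuous_pi fun ik => continuous_coordinate hb hψ (fun s => ?_) ik.1 ik.2
    have : IsOpen {P : Prim S | s ∉ P.1} := TopologicalSpace.isOpen_generateFrom_of_mem ⟨s, rfl⟩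
    convert this.preimage continuous_subtype_val using 1
    ext z
    exact (hmem s z).symm
  have hind : Topology.IsInducing Θ := by
    refine ⟨le_antisymm hcont.le_induced ?_⟩
    rw [instTopologicalSpaceSubtype, instTopologicalSpacePrim, induced_generateFrom_eq]
    refine le_generateFrom ?_
    rintro _ ⟨_, ⟨s, rfl⟩, rfl⟩
    -- In the topology induced by `Θ` the coordinates are continuous by construction, hence so are
    -- all matrix coefficients, whose nonvanishing describes the hull-kernel open sets.
    let _ : TopologicalSpace (primOfDim S (δ + 1)) := TopologicalSpace.induced Θ inferInstance
    have hΘ : Continuous Θ := continuous_induced_dom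
    have hin := continuous_inner hb hS fun i k => (continuous_apply (i, k)).comp hΘ
    have : (Subtype.val ⁻¹' {P : Prim S | s ∉ P.1} : Set (primOfDim S (δ + 1)))
        = ⋃ k, ⋃ l, {z | ⟪b z k, (ρ z).π s (b z l)⟫_ℂ ≠ 0} := by
      ext z
      change s ∉ z.1.1 ↔ _
      rw [hmem]
      simp only [Set.mem_iUnion, Set.mem_ofPred_eq]
      rw [← not_iff_not]
      push Not
      constructor
      · intro h k l
        rw [h, zero_apply, inner_zero_right]
      · intro h
        refine ContinuousLinearMap.coe_injective ((b z).toBasis.ext fun l => ?_)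
        rw [OrthonormalBasis.coe_toBasis]
        change (ρ z).π s (b z l) = 0
        rw [← (b z).sum_repr' ((ρ z).π s (b z l))]
        exact Finset.sum_eq_zero fun k _ => by rw [h k l, zero_smul]
    rw [this]
    exact isOpen_iUnion fun k => isOpen_iUnion fun l =>
      (isOpen_compl_singleton (x := (0 : ℂ))).preimage (hin s k l)
  have := CoveringDimLE.of_isInducing hind
  rwa [Nat.card_prod, Nat.card_fin] at this

end IrrRep

/-! ### Minimal homeomorphisms -/

section Dynamics

variable {X : Type*} [TopologicalSpace X] {σ : X ≃ₜ X}

/-- By minimality the translates of the interior of `V` cover `X`. Finitely many suffice, and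
starting from `σ^M x` makes all their exponents nonnegative. -/
theorem IsMinimalHomeo.exists_return_bound [CompactSpace X] (hσ : IsMinimalHomeo σ) {y : X}
    {V : Set X} (hV : V ∈ 𝓝 y) : ∃ N : ℕ, ∀ x, ∃ k < N, (σ ^ (k : ℤ)) x ∈ V := by
  have hcov : ⋃ k : ℤ, (σ ^ k : X ≃ₜ X) ⁻¹' interior V = Set.univ := by
    have hcl : IsClosed (⋃ k : ℤ, (σ ^ k : X ≃ₜ X) ⁻¹' interior V)ᶜ :=
      (isOpen_iUnion fun k => isOpen_interior.preimage (σ ^ k : X ≃ₜ X).continuous).isClosed_compl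
    have hmem : ∀ x, σ x ∈ (⋃ k : ℤ, (σ ^ k : X ≃ₜ X) ⁻¹' interior V)
        ↔ x ∈ ⋃ k : ℤ, (σ ^ k : X ≃ₜ X) ⁻¹' interior V := by
      intro x
      have : ∀ k : ℤ, (σ ^ k) (σ x) = (σ ^ (k + 1)) x := fun k => by
        rw [Homeomorph.zpow_add_apply, zpow_one]
      simp only [Set.mem_iUnion, Set.mem_preimage, this]
      exact ⟨fun ⟨k, hk⟩ => ⟨k + 1, hk⟩, fun ⟨k, hk⟩ => ⟨k - 1, by rwa [sub_add_cancel]⟩⟩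
    rcases hσ _ hcl (by
      ext x
      constructor
      · rintro ⟨z, hz, rfl⟩ h
        exact hz ((hmem z).mp h)
      · intro hx
        refine ⟨σ.symm x, fun h => hx ?_, by simp⟩
        simpa using (hmem _).mpr h) with h | h
    · exact Set.compl_empty_iff.mp h
    · have hy : y ∈ (⋃ k : ℤ, (σ ^ k : X ≃ₜ X) ⁻¹' interior V)ᶜ := h ▸ Set.mem_univ y
      exact absurd (Set.mem_iUnion.mpr ⟨0, by simpa using mem_interior_iff_mem_nhds.mpr hV⟩) hy
  obtain ⟨t, ht⟩ := isCompact_univ.elim_finite_subcover _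
    (fun k : ℤ => isOpen_interior.preimage (σ ^ k : X ≃ₜ X).continuous) hcov.ge
  let M := t.sup Int.natAbs
  refine ⟨2 * M + 1, fun x => ?_⟩
  obtain ⟨k, hk, hkx⟩ : ∃ k ∈ t, (σ ^ k) ((σ ^ (M : ℤ)) x) ∈ interior V := by
    simpa using ht (Set.mem_univ ((σ ^ (M : ℤ)) x))
  have hkM : k.natAbs ≤ M := Finset.le_sup (f := Int.natAbs) hk
  refine ⟨(k + M).toNat, by omega, interior_subset ?_⟩
  rwa [Int.toNat_of_nonneg (by omega), Homeomorph.zpow_add_apply]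

/-- A periodic orbit would be a finite, hence closed, nonempty invariant set in an infinite space.
-/
theorem IsMinimalHomeo.zpow_apply_ne [T1Space X] [Infinite X] (hσ : IsMinimalHomeo σ) (y : X)
    {k : ℕ} (hk : k ≠ 0) : (σ ^ (k : ℤ)) y ≠ y := by
  intro hy
  have hper : ∀ j : ℤ, (σ ^ ((k : ℤ) * j)) y = y := by
    intro j
    rw [zpow_mul]
    induction j using Int.induction_on with
    | zero => rfl
    | succ j ih => rw [Homeomorph.zpow_add_apply, zpow_one, hy, ih]
    | pred j ih =>
      rw [sub_eq_add_neg, Homeomorph.zpow_add_apply, zpow_neg_one]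
      have : ((σ ^ (k : ℤ))⁻¹ : X ≃ₜ X) y = y := (Homeomorph.symm_apply_eq _).mpr hy.symm
      rw [this, ih]
  have hfin : (Set.range fun j : ℤ => (σ ^ j) y).Finite := by
    refine ((Set.finite_Ico (0 : ℤ) k).image fun j : ℤ => (σ ^ j) y).subset ?_
    rintro _ ⟨j, rfl⟩
    have hk' : (0 : ℤ) < k := by omega
    refine ⟨j % k, ⟨Int.emod_nonneg _ hk'.ne', Int.emod_lt_of_pos _ hk'⟩, ?_⟩
    simp only
    conv_rhs => rw [← Int.emod_add_mul_ediv j k, Homeomorph.zpow_add_apply, hper]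
  rcases hσ _ hfin.isClosed (by
    ext x
    constructor
    · rintro ⟨_, ⟨j, rfl⟩, rfl⟩
      refine ⟨1 + j, ?_⟩
      simp only [Homeomorph.zpow_add_apply, zpow_one]
    · rintro ⟨j, rfl⟩
      refine ⟨_, ⟨-1 + j, rfl⟩, ?_⟩
      simp only [Homeomorph.zpow_add_apply, zpow_neg_one]
      exact σ.apply_symm_apply _) with h | h
  · exact (Set.range_nonempty _).ne_empty h
  · exact Set.infinite_univ (h ▸ hfin)

theorem IsMinimalHomeo.exists_nhds_no_return [T2Space X] [Infinite X] (hσ : IsMinimalHomeo σ)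
    (y : X) (J : ℕ) : ∃ B ∈ 𝓝 y, ∀ k : ℕ, k ≠ 0 → k ≤ J → ∀ z ∈ B, (σ ^ (k : ℤ)) z ∉ B := by
  have key : ∀ k : ℕ, k ≠ 0 → ∃ B ∈ 𝓝 y, ∀ z ∈ B, (σ ^ (k : ℤ)) z ∉ B := by
    intro k hk
    obtain ⟨U, V, hU, hV, hUV⟩ := t2_separation_nhds (hσ.zpow_apply_ne y hk)
    refine ⟨V ∩ (σ ^ (k : ℤ) : X ≃ₜ X) ⁻¹' U, Filter.inter_mem hV
      ((σ ^ (k : ℤ) : X ≃ₜ X).continuous.continuousAt hU), fun z hz hz' => ?_⟩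
    exact Set.disjoint_left.mp hUV hz.2 hz'.1
  choose! B hB hBk using key
  refine ⟨⋂ k ∈ {k | k ≠ 0 ∧ k ≤ J}, B k, (Filter.biInter_mem
    ((Set.finite_le_nat J).subset fun k hk => hk.2)).mpr fun k hk => hB k hk.1,
    fun k hk hkJ z hz hz' => ?_⟩
  exact hBk k hk z (Set.mem_iInter₂.mp hz k ⟨hk, hkJ⟩) (Set.mem_iInter₂.mp hz' k ⟨hk, hkJ⟩)

end Dynamics

/-! ### The subalgebra generated by finitely many functions and a weighted unitary -/

/-- Products of homogeneous elements and their adjoints are homogeneous, so all monomials in the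
generators are. -/
theorem CovariantPair.dense_span_homog {X : Type*} [TopologicalSpace X] {σ : X ≃ₜ X} {A : Type*}
    [CStarAlgebra A] {P : CovariantPair σ A} {Y : Set X} {G : Set A} {S : StarSubalgebra ℂ A}
    (hS : S = (StarAlgebra.adjoin ℂ G).topologicalClosure)
    (hG : ∀ s ∈ G, ∃ n a, P.Homog Y n a s) :
    Dense (Submodule.span ℂ {s : S | ∃ n a, P.Homog Y n a s} : Set S) := by
  have hsub : StarAlgebra.adjoin ℂ G ≤ S := (StarSubalgebra.le_topologicalClosure _).trans hS.ge
  have hmon : ∀ s ∈ Submonoid.closure (G ∪ star G), ∃ n a, P.Homog Y n a s := by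
    intro s hs
    induction hs using Submonoid.closure_induction with
    | mem s hs =>
      rcases hs with hs | hs
      · exact hG s hs
      · obtain ⟨n, a, h⟩ := hG _ hs
        exact ⟨_, _, star_star s ▸ h.star⟩
    | one => exact ⟨0, 1, P.homog_one Y⟩
    | mul s t _ _ hs ht =>
      obtain ⟨n, a, hs⟩ := hs
      obtain ⟨m, b, ht⟩ := ht
      exact ⟨_, _, hs.mul ht⟩
  have hadj : ∀ s (hs : s ∈ StarAlgebra.adjoin ℂ G),
      (⟨s, hsub hs⟩ : S) ∈ Submodule.span ℂ {s : S | ∃ n a, P.Homog Y n a s} := by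
    have heq := StarAlgebra.adjoin_eq_span (R := ℂ) G
    have hle : ∀ s, s ∈ Submodule.span ℂ (Submonoid.closure (G ∪ star G) : Set A) ↔
        s ∈ StarAlgebra.adjoin ℂ G := fun s => by
      rw [← heq]; rfl
    intro s hs
    have hs' := (hle s).mpr hs
    induction hs' using Submodule.span_induction with
    | mem s hs' => exact Submodule.subset_span (hmon s hs')
    | zero => exact Submodule.zero_mem _
    | add s t hs₁ ht₁ ihs iht =>
      exact Submodule.add_mem _ (ihs ((hle s).mp hs₁)) (iht ((hle t).mp ht₁))
    | smul z s hs₁ ihs => exact Submodule.smul_mem _ z (ihs ((hle s).mp hs₁))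
  intro s
  rw [Metric.mem_closure_iff]
  intro ε hε
  have hs : (s : A) ∈ closure (StarAlgebra.adjoin ℂ G : Set A) := hS.le s.2
  obtain ⟨a, ha, hsa⟩ := Metric.mem_closure_iff.mp hs ε hε
  exact ⟨_, hadj a ha, hsa⟩

/-- The canonical covariant pair of the crossed product. -/
def CrossedProduct.covariantPair {X : Type u} [TopologicalSpace X] [CompactSpace X] (σ : X ≃ₜ X) :
    CovariantPair σ (CrossedProduct σ) where
  π := ofFun σ
  U := ⟨u σ, u_mem_unitary σ⟩
  covariant f := by
    rw [← CrossedProduct.covariant, mul_assoc, (u_mem_unitary σ).1, mul_one]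

/-- A continuous function with small zero set around `y` that is equal to one off `U`. -/
theorem exists_cutoff {X : Type*} [TopologicalSpace X] [NormalSpace X] [T1Space X] {y : X}
    {U : Set X} (hU : U ∈ 𝓝 y) :
    ∃ h : C(X, ℝ), {x | h x = 0} ∈ 𝓝 y ∧ (∀ x, h x = 0 → x ∈ U) ∧ ∀ x ∉ U, h x = 1 := by
  obtain ⟨F, hF0, hF1, -⟩ := exists_continuous_zero_one_of_isClosed (isClosed_singleton (x := y))
    (isOpen_interior (s := U)).isClosed_compl
    (Set.disjoint_singleton_left.mpr fun h => h (mem_interior_iff_mem_nhds.mpr hU))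
  have h1 : ∀ x ∉ U, max (2 * F x - 1) 0 = 1 := fun x hx => by
    rw [hF1 fun h => hx (interior_subset h)]
    norm_num
  -- Passing from `F` to `max (2 F - 1) 0` widens the zero set to contain the neighbourhood `{F <
  -- 1/2}` of `y`.
  refine ⟨⟨fun x => max (2 * F x - 1) 0, by fun_prop⟩, ?_, fun x hx => ?_, h1⟩
  · have hy : F y < 1 / 2 := by rw [hF0 rfl]; norm_num
    filter_upwards [(isOpen_lt F.continuous continuous_const).mem_nhds hy] with x hx
    have hx' : F x < 1 / 2 := hx
    exact max_eq_right (by linarith)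
  · by_contra hxU
    exact one_ne_zero ((h1 x hxU).symm.trans hx)

theorem realToRCLike_re_add_im {X : Type*} [TopologicalSpace X] (f : C(X, ℂ)) :
    f = ((⟨Complex.re, Complex.continuous_re⟩ : C(ℂ, ℝ)).comp f).realToRCLike ℂ
      + Complex.I • ((⟨Complex.im, Complex.continuous_im⟩ : C(ℂ, ℝ)).comp f).realToRCLike ℂ := by
  ext x
  simp [mul_comm Complex.I, Complex.re_add_im]

/-- The representation theory of the C*-algebra generated by finitely many real functions, one of
which is `h`, and `u h`, when the return times to the zero set of `h` lie between `J` and `N`. -/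
theorem CovariantPair.irrRep_and_dimRatio {X : Type*} [TopologicalSpace X] [CompactSpace X]
    {σ : X ≃ₜ X} {A : Type u} [CStarAlgebra A] (P : CovariantPair σ A) {κ : Type*} [Finite κ]
    (ψ : κ → C(X, ℝ)) (i₀ : κ) {N J : ℕ} (hN : ∀ x, ∃ k < N, ψ i₀ ((σ ^ (k : ℤ)) x) = 0)
    (hJ : ∀ k : ℕ, k ≠ 0 → k ≤ J → ∀ x, ψ i₀ x = 0 → ψ i₀ ((σ ^ (k : ℤ)) x) ≠ 0)
    (S : StarSubalgebra ℂ A)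
    (hS : S = (StarAlgebra.adjoin ℂ (Set.range (fun i => P.π ((ψ i).realToRCLike ℂ)) ∪
      {(P.U : A) * P.π ((ψ i₀).realToRCLike ℂ)})).topologicalClosure) :
    (∀ ρ : IrrRep S, ∃ d, ρ.HasDim d ∧ d ≤ N ∧ J ≤ d) ∧ dimRatio S ≤ (Nat.card κ : ℝ≥0∞) := by
  have hScl : IsClosed (S : Set A) := by
    rw [hS]
    exact StarSubalgebra.isClosed_topologicalClosure _
  let T : S := ⟨(P.U : A) * P.π ((ψ i₀).realToRCLike ℂ), hS.ge
    (StarSubalgebra.le_topologicalClosure _ (StarAlgebra.subset_adjoin ℂ _ (Or.inr rfl)))⟩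
  have hdense := CovariantPair.dense_span_homog (P := P) (Y := {x | ψ i₀ x = 0}) hS (by
    rintro s (⟨k, rfl⟩ | rfl)
    · exact ⟨0, _, P.homog_zero _ _⟩
    · refine ⟨1, (ψ i₀).realToRCLike ℂ, by rw [zpow_one], fun x hx k hk hkY => hx ?_⟩
      obtain rfl : k = 0 := by omega
      exact Complex.ofReal_eq_zero.mpr hkY)
  have hbasis : ∀ ρ : IrrRep S, ∃ (x : X) (δ : ℕ) (b : OrthonormalBasis (Fin (δ + 1)) ℂ ρ.H),
      IrrRep.IsOrbitBasis P (ψ i₀) T ρ x b := fun ρ =>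
    ρ.exists_isOrbitBasis hdense (fun x => Iff.rfl) rfl hN
  refine ⟨fun ρ => ?_, iSup₂_le fun d _ => ENNReal.div_le_of_le_mul ?_⟩
  · obtain ⟨x, δ, b, hb⟩ := hbasis ρ
    refine ⟨δ + 1, ⟨b.toBasis.finiteDimensional_of_finite, ?_⟩, ?_, ?_⟩
    · rw [Module.finrank_eq_card_basis b.toBasis, Fintype.card_fin]
    · obtain ⟨k, hk, hkY⟩ := hN x
      by_contra! hlt
      exact hb.ne_zero k (by omega) hkY
    · by_contra! hlt
      -- Both `σ⁻¹ x` and `σ^δ x` are zeros of `h`, at `δ + 1` steps from each other.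
      refine hJ (δ + 1) δ.succ_ne_zero hlt.le _ hb.pred_eq_zero ?_
      rw [← Homeomorph.zpow_add_apply, Nat.cast_succ, add_neg_cancel_right]
      exact hb.last_eq_zero
  · have hcov : CoveringDimLE (primOfDim S d) (Nat.card κ * d) :=
      IrrRep.coveringDim_primOfDim_le (ψ := ψ) (i₀ := i₀) (T := T) hS hbasis d
    have hle : coveringDim (primOfDim S d) ≤ ((Nat.card κ * d : ℕ) : ℕ∞) :=
      iInf₂_le (Nat.card κ * d) hcov
    rw [← Nat.cast_mul]
    exact_mod_cast ENat.toENNReal_le.mpr hle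

end

/-! ### Choice of the cutoff and the generators -/

theorem theorem5p1 {X : Type u} [TopologicalSpace X] [CompactSpace X]
    [TopologicalSpace.MetrizableSpace X] [Infinite X]
    (σ : X ≃ₜ X) (hσ : IsMinimalHomeo σ) (y : X) (W : Set X) (hW : IsOpen W) (hy : y ∈ W)
    {n m : ℕ} (f : Fin n → C(X, ℂ)) (g : Fin m → C(X, ℂ))
    (hg : ∀ j, ∀ x ∈ W, g j x = 0) (ε : ℝ) (hε : 0 < ε) :
    ∃ R : ℝ, 0 < R ∧ ∀ J : ℕ,
      ∃ Y : Set X, IsClosed Y ∧ Y ∈ 𝓝 y ∧ Y ⊆ W ∧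
      ∃ S : StarSubalgebra ℂ (CrossedProduct σ),
        IsClosed (S : Set (CrossedProduct σ)) ∧
        S ≤ CrossedProduct.orbitBreaking σ Y ∧
        (∀ i, ∃ s ∈ S, ‖CrossedProduct.ofFun σ (f i) - s‖ < ε) ∧
        (∀ j, ∃ s ∈ S, ‖CrossedProduct.u σ * CrossedProduct.ofFun σ (g j) - s‖ < ε) ∧
        IsSubhomogeneous S ∧
        dimRatio S ≤ ENNReal.ofReal R ∧
        ∀ ρ : IrrRep S, ∀ d : ℕ, ρ.HasDim d → J ≤ d := by
  -- The index `none` stands for `h`, the others for real and imaginary parts. Only `h` depends on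
  -- `J`, so the number of generating functions can serve as `R`.
  let κ := Option ((Fin n ⊕ Fin m) × Bool)
  refine ⟨Nat.card κ, Nat.cast_pos.mpr Nat.card_pos, fun J => ?_⟩
  obtain ⟨B, hB, hBJ⟩ := hσ.exists_nhds_no_return y J
  obtain ⟨h, hnhds, hU, hone⟩ := exists_cutoff (Filter.inter_mem hB (hW.mem_nhds hy))
  set Y : Set X := {x | h x = 0} with hYdef
  have hYcl : IsClosed Y := isClosed_eq h.continuous continuous_const
  obtain ⟨N, hN⟩ := hσ.exists_return_bound hnhds
  let P := CrossedProduct.covariantPair σ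
  let ψ : κ → C(X, ℝ) := fun k => k.elim h fun p =>
    (if p.2 then ⟨Complex.re, Complex.continuous_re⟩ else ⟨Complex.im, Complex.continuous_im⟩ :
      C(ℂ, ℝ)).comp (Sum.elim f g p.1)
  let G : Set (CrossedProduct σ) := Set.range (fun k => P.π ((ψ k).realToRCLike ℂ)) ∪
    {(P.U : CrossedProduct σ) * P.π (h.realToRCLike ℂ)}
  let S : StarSubalgebra ℂ (CrossedProduct σ) := (StarAlgebra.adjoin ℂ G).topologicalClosure
  have hScl : IsClosed (S : Set (CrossedProduct σ)) :=
    StarSubalgebra.isClosed_topologicalClosure _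
  have hGS : ∀ a ∈ G, a ∈ S := fun a ha =>
    StarSubalgebra.le_topologicalClosure _ (StarAlgebra.subset_adjoin ℂ _ ha)
  have hhY : ∀ x ∈ Y, (h.realToRCLike ℂ : C(X, ℂ)) x = 0 := fun x hx => by
    change ((h x : ℝ) : ℂ) = 0
    rw [show h x = 0 from hx, Complex.ofReal_zero]
  obtain ⟨hdim, hratio⟩ := P.irrRep_and_dimRatio ψ none (J := J) hN
    (fun k hk hkJ x hx hx' => hBJ k hk hkJ x (hU x hx).1 (hU _ hx').1) S rfl
  have hfun : ∀ p, P.π (Sum.elim f g p) ∈ S := by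
    intro p
    rw [realToRCLike_re_add_im (Sum.elim f g p), map_add, map_smul]
    exact add_mem (hGS _ (Or.inl ⟨some (p, true), rfl⟩))
      (S.smul_mem (hGS _ (Or.inl ⟨some (p, false), rfl⟩)) _)
  refine ⟨Y, hYcl, hnhds, fun x hx => (hU x hx).2, S, hScl, ?_, fun i => ?_, fun j => ?_, ?_, ?_, ?_⟩
  · refine StarSubalgebra.topologicalClosure_mono (StarAlgebra.adjoin_le ?_)
    rintro s (⟨k, rfl⟩ | rfl)
    · exact StarAlgebra.subset_adjoin ℂ _ (Or.inl ⟨_, rfl⟩)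
    · exact StarAlgebra.subset_adjoin ℂ _ (Or.inr ⟨_, hhY, rfl⟩)
  · exact ⟨_, hfun (Sum.inl i), by
      change ‖CrossedProduct.ofFun σ (f i) - CrossedProduct.ofFun σ (f i)‖ < ε
      rwa [sub_self, norm_zero]⟩
  · refine ⟨_, mul_mem (hGS _ (Or.inr rfl)) (hfun (Sum.inr j)), ?_⟩
    -- Where `h` differs from one, the point lies in `W` and `g j` vanishes. So `u g_j = (u h) g_j`
    -- lies in `S` itself.
    have hhg : h.realToRCLike ℂ * g j = g j := by
      ext x
      change ((h x : ℝ) : ℂ) * g j x = g j x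
      by_cases hx : x ∈ W
      · rw [hg j x hx, mul_zero]
      · rw [hone x fun hx' => hx hx'.2, Complex.ofReal_one, one_mul]
    have : (P.U : CrossedProduct σ) * P.π (h.realToRCLike ℂ) * P.π (Sum.elim f g (Sum.inr j))
        = CrossedProduct.u σ * CrossedProduct.ofFun σ (g j) := by
      change (CrossedProduct.u σ * CrossedProduct.ofFun σ (h.realToRCLike ℂ))
        * CrossedProduct.ofFun σ (g j) = _
      rw [mul_assoc, ← map_mul, hhg]
    rwa [this, sub_self, norm_zero]
  · exact ⟨N, fun ρ => by
      obtain ⟨d, hd, hdN, -⟩ := hdim ρ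
      exact ⟨d, hdN, hd⟩⟩
  · rwa [ENNReal.ofReal_natCast]
  · intro ρ d hd
    obtain ⟨d', hd', -, hJ⟩ := hdim ρ
    rwa [← hd.2, hd'.2]
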